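/- Setting. Let $A_p\in\mathbb{R}^{n\times n}$, $B_p\in\mathbb{R}^{n\times m}$, $\Lambda=\mathrm{diag}(\lambda_1,\dots,\lambda_m)$ with all $\lambda_i>0$, and consider the plant $\dot x_p=A_px_p+B_p\Lambda B_{sat}(u)$, where $u_{max}>0$, $B_{sat}(u)=u$ if $\|u\|\le u_{max}$ and $B_{sat}(u)=\frac{u_{max}}{\|u\|}u$ otherwise; the reference model $\dot x_m=A_mx_m+B_mr$ with $A_m$ Hurwitz, $B_m\in\mathbb{R}^{n\times m}$ of full column rank and $r$ continuous; and ideal gains $K_x,K_r$ with $A_p+B_p\Lambda K_x=A_m$, $B_p\Lambda K_r=B_m$. Put $\Theta_a=[K_x,K_r,\Lambda]$, and let $\widehat\Theta_a=[\hat K_x,\hat K_r,\hat\Lambda]$ be its estimate. The control is $u=\hat K_xx_p+\hat K_rr$; let $\Delta u=B_{sat}(u)-u$, $\Phi_a=[x_p^T,r^T,-\Delta u^T]^T$, $\dot e_\Delta=A_me_\Delta+B_p\hat\Lambda\Delta u$, $e_u=x_p-x_m-e_\Delta$. The adaptation laws are $$\dot\Xi_a=-\gamma B_p^TPe_u\Phi_a^T,\qquad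 \dot{\widehat\Theta}_a=-\beta(\widehat\Theta_a-\Xi_a)(1+\mu\Phi_a^T\Phi_a),\qquad \mu\ge\frac{2\gamma}{\beta}\|PB_p\|_F^2,$$ with $\gamma,\beta>0$, where $P$ solves $A_m^TP+PA_m=-Q$ with $Q=Q^T\succ0$ and $Q\succeq\max(1,\lambda_i)I$ for every $i$. Two versions of the laws are considered: the last block $\hat\Lambda$ is adapted as a full matrix, or only its diagonal $\hat\lambda$ is adapted (the last blocks of $\widehat\Theta_a$ and $\Xi_a$ are diagonal, and the off-diagonal entries in the last block of $-\gamma B_p^TPe_u\Phi_a^T$ are discarded). With $\widetilde\Theta_a=\widehat\Theta_a-\Theta_a=[\widetilde\Theta,\widetilde\Lambda]$, where $\widetilde\Lambda=\hat\Lambda-\Lambda$, the errors satisfy $\dot e_u=A_me_u+B_p[\Lambda\widetilde\Theta,\widetilde\Lambda]\Phi_a$ together with the above laws; this is the adaptive error system driven by $\Phi_a$, with state $z=(e_u,\ \Xi_a-\Theta_a,\ \widetilde\Theta_a)$. A bounded $\Phi:[t_0,\infty)\to\mathbb{R}^N$ is persistently exciting (PE) if there are $T,\delta_0,\epsilon>0$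 such that for every $t\ge t_0$ and every unit vector $\omega\in\mathbb{R}^N$ there is $[t_2,t_2+\delta_0]\subset[t,t+T]$ with $\frac1T\bigl|\int_{t_2}^{t_2+\delta_0}\Phi(\tau)^T\omega\,d\tau\bigr|\ge\epsilon$. Theorem. In both versions of the adaptation laws: (1) If $\Phi_a:[t_0,\infty)\to\mathbb{R}^{n+2m}$ is continuous, bounded and persistently exciting, then the origin $e_u=0$, $\Xi_a-\Theta_a=0$, $\widetilde\Theta_a=0$ of the adaptive error system driven by $\Phi_a$ is uniformly asymptotically stable (uniformly stable and uniformly attractive with respect to the initial time $t_1\ge t_0$). Moreover, for all $\epsilon_1,\delta>0$ there is $T_{adap}<\infty$, independent of $t_1\ge t_0$, such that every solution with $\|z(t_1)\|\le\epsilon_1$ satisfies $\|\widetilde\Theta_a(t)\|\le\delta$ for all $t\ge t_1+T_{adap}$. (2) The same stability, attractivity and finite-time accuracy hold for the errors $z$ along the trajectories, starting at any $t_1\ge t_0$, of the full nonlinear closed loop whose own regressor $\Phi_a$ is bounded by $C$ and PE on $[t_1,\infty)$ with constants $T,\delta_0,\epsilon$, uniformly over all such trajectories, for any given $C$ and any given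 $T,\delta_0,\epsilon>0$. -/

import Mathlib

open Set

/-- Euclidean norm of a real vector given by its coordinates. -/
noncomputable def l2norm {ι : Type*} [Fintype ι] (v : ι → ℝ) : ℝ :=
  ‖(WithLp.toLp 2 v : EuclideanSpace ℝ ι)‖

/-- Frobenius norm of a real matrix. -/
noncomputable def frobNorm {ι κ : Type*} [Fintype ι] [Fintype κ] (M : Matrix ι κ ℝ) : ℝ :=
  l2norm (fun p : ι × κ => M p.1 p.2)

/-- A real square matrix is Hurwitz if all its complex eigenvalues have negative real part. -/
def IsHurwitz {ι : Type*} [Fintype ι] [DecidableEq ι] (A : Matrix ι ι ℝ) : Prop :=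
  ∀ z ∈ spectrum ℂ (A.map (algebraMap ℝ ℂ)), z.re < 0

/-- Saturation of a vector by the closed Euclidean ball of radius `umax` about the origin. -/
noncomputable def ballSat {ι : Type*} [Fintype ι] (umax : ℝ) (u : ι → ℝ) : ι → ℝ :=
  open Classical in if l2norm u ≤ umax then u else (umax / l2norm u) • u

/-- Index set of the augmented regressor `[x_p; r; -Δu]`. -/
abbrev RegIdx (n m : ℕ) : Type := Fin n ⊕ (Fin m ⊕ Fin m)

/-- Augmented parameter matrices `[K_x, K_r, Λ]`, with `m` rows. -/
abbrev ParamMatrix (n m : ℕ) : Type := Matrix (Fin m) (RegIdx n m) ℝ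

/-- Persistent excitation on `[t₀, ∞)` with window `T`, sub-window `δ₀` and level `ε`. -/
def PersistentlyExcitingWith {ι : Type*} [Fintype ι]
    (T δ₀ ε t₀ : ℝ) (Φ : ℝ → ι → ℝ) : Prop :=
  ∀ t, t₀ ≤ t → ∀ ω : ι → ℝ, l2norm ω = 1 →
    ∃ t₂, t ≤ t₂ ∧ t₂ + δ₀ ≤ t + T ∧
      ε ≤ 1 / T * |∫ τ in t₂..(t₂ + δ₀), Φ τ ⬝ᵥ ω|

/-- A bounded signal on `[t₀, ∞)` that is persistently exciting. -/
def PersistentlyExciting {ι : Type*} [Fintype ι] (t₀ : ℝ) (Φ : ℝ → ι → ℝ) : Prop :=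
  (∃ C, ∀ t, t₀ ≤ t → l2norm (Φ t) ≤ C) ∧
    ∃ T δ₀ ε : ℝ, 0 < T ∧ 0 < δ₀ ∧ 0 < ε ∧ PersistentlyExcitingWith T δ₀ ε t₀ Φ

/-- The constant data: plant `(Ap, Bp, Λ = diag lam)`, saturation radius `umax`, reference model
`(Am, Bm)`, ideal gains `(Kx, Kr)`, Lyapunov matrices `(P, Q)` and tuner gains. -/
structure MSACData (n m : ℕ) where
  Ap : Matrix (Fin n) (Fin n) ℝ
  Bp : Matrix (Fin n) (Fin m) ℝ
  lam : Fin m → ℝ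
  umax : ℝ
  Am : Matrix (Fin n) (Fin n) ℝ
  Bm : Matrix (Fin n) (Fin m) ℝ
  Kx : Matrix (Fin m) (Fin n) ℝ
  Kr : Matrix (Fin m) (Fin m) ℝ
  P : Matrix (Fin n) (Fin n) ℝ
  Q : Matrix (Fin n) (Fin n) ℝ
  γ : ℝ
  β : ℝ
  μ : ℝ

/-- How the block `Λ̂` estimating `Λ` is adapted: either as a full matrix, or only through its
diagonal `diag(λ̂)`. -/
inductive GainAdaptation
  | full
  | diagonal

/-- The projection of a parameter matrix onto the set of adapted parameters: the identity in the
full case, deletion of the off-diagonal entries of the last block in the diagonal case. -/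
def GainAdaptation.proj {n m : ℕ} : GainAdaptation → ParamMatrix n m → ParamMatrix n m
  | .full, M => M
  | .diagonal, M => fun i => Sum.elim (fun j => M i (.inl j))
      (Sum.elim (fun j => M i (.inr (.inl j)))
        (fun j => if i = j then M i (.inr (.inr j)) else 0))

namespace MSACData

variable {n m : ℕ} (S : MSACData n m)

/-- The control effectiveness `Λ`. -/
def Lam : Matrix (Fin m) (Fin m) ℝ := Matrix.diagonal S.lam

/-- The true augmented parameter `Θ_a = [K_x, K_r, Λ]`. -/
def Theta : ParamMatrix n m :=
  fun i => Sum.elim (S.Kx i) (Sum.elim (S.Kr i) (S.Lam i))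

/-- The block matrix `[Λ Θ₁, Θ₂]` for a parameter matrix `[Θ₁, Θ₂]`, where `Θ₂` is the last
(square) block. -/
def scaled (M : ParamMatrix n m) : ParamMatrix n m :=
  fun i => Sum.elim (fun j => S.lam i * M i (.inl j))
    (Sum.elim (fun j => S.lam i * M i (.inr (.inl j))) (fun j => M i (.inr (.inr j))))

/-- The normalization `𝒩_t = 1 + μ Φ_aᵀ Φ_a`. -/
def normalizer (φ : RegIdx n m → ℝ) : ℝ := 1 + S.μ * (φ ⬝ᵥ φ)

/-- Right-hand side `-γ B_pᵀ P e_u Φ_aᵀ` of the law for `Ξ_a`, restricted to the adapted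
parameters. -/
def tunerRate (mode : GainAdaptation) (e : Fin n → ℝ) (φ : RegIdx n m → ℝ) :
    ParamMatrix n m :=
  mode.proj (-(S.γ • Matrix.vecMulVec (S.Bp.transpose.mulVec (S.P.mulVec e)) φ))

end MSACData

/-- Error state: augmented error `e_u`, tuner error `Ξ_a - Θ_a`, parameter error
`Θ̂_a - Θ_a`. -/
structure ErrState (n m : ℕ) where
  e : Fin n → ℝ
  Xi : ParamMatrix n m
  Th : ParamMatrix n m

/-- Euclidean norm of the error state. -/
noncomputable def ErrState.size {n m : ℕ} (z : ErrState n m) : ℝ :=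
  Real.sqrt (l2norm z.e ^ 2 + frobNorm z.Xi ^ 2 + frobNorm z.Th ^ 2)

/-- `z` solves on `[t₁, ∞)` the adaptive error system driven by the regressor `Φ`. -/
structure IsErrorSolution {n m : ℕ} (S : MSACData n m) (mode : GainAdaptation)
    (Φ : ℝ → RegIdx n m → ℝ) (t₁ : ℝ) (z : ℝ → ErrState n m) : Prop where
  Xi_mem : ∀ t, t₁ ≤ t → mode.proj (z t).Xi = (z t).Xi
  Th_mem : ∀ t, t₁ ≤ t → mode.proj (z t).Th = (z t).Th
  deriv_e : ∀ t, t₁ ≤ t → HasDerivWithinAt (fun s => (z s).e)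
    (S.Am.mulVec (z t).e + S.Bp.mulVec ((S.scaled (z t).Th).mulVec (Φ t))) (Ici t₁) t
  deriv_Xi : ∀ t, t₁ ≤ t → ∀ i j, HasDerivWithinAt (fun s => (z s).Xi i j)
    (S.tunerRate mode (z t).e (Φ t) i j) (Ici t₁) t
  deriv_Th : ∀ t, t₁ ≤ t → ∀ i j, HasDerivWithinAt (fun s => (z s).Th i j)
    (-(S.β * ((z t).Th i j - (z t).Xi i j) * S.normalizer (Φ t))) (Ici t₁) t

/-- The signals of the closed loop: plant state, reference model state, auxiliary error `e_Δ`,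
reference input, estimates `Θ̂_a = [K̂_x, K̂_r, Λ̂]` and tuner state `Ξ_a`. -/
structure Signals (n m : ℕ) where
  xp : ℝ → Fin n → ℝ
  xm : ℝ → Fin n → ℝ
  eD : ℝ → Fin n → ℝ
  r : ℝ → Fin m → ℝ
  ThHat : ℝ → ParamMatrix n m
  Xi : ℝ → ParamMatrix n m

namespace Signals

variable {n m : ℕ} (s : Signals n m)

/-- The control `u = K̂_x x_p + K̂_r r`. -/
def u (t : ℝ) : Fin m → ℝ := fun i =>
  (∑ j, s.ThHat t i (.inl j) * s.xp t j) + ∑ j, s.ThHat t i (.inr (.inl j)) * s.r t j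

/-- The saturation deficiency `Δu = B_sat(u) - u`. -/
noncomputable def du (umax : ℝ) (t : ℝ) : Fin m → ℝ := ballSat umax (s.u t) - s.u t

/-- The estimate `Λ̂` of `Λ`: the last block of `Θ̂_a`. -/
def LamHat (t : ℝ) : Matrix (Fin m) (Fin m) ℝ := fun i j => s.ThHat t i (.inr (.inr j))

/-- The augmented regressor `Φ_a = [x_p; r; -Δu]`. -/
noncomputable def regressor (umax : ℝ) (t : ℝ) : RegIdx n m → ℝ :=
  Sum.elim (s.xp t) (Sum.elim (s.r t) (-(s.du umax t)))

/-- The augmented error `e_u = x_p - x_m - e_Δ`. -/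
def eu (t : ℝ) : Fin n → ℝ := s.xp t - s.xm t - s.eD t

/-- The error state along the closed-loop signals. -/
def err (S : MSACData n m) (t : ℝ) : ErrState n m :=
  ⟨s.eu t, s.Xi t - S.Theta, s.ThHat t - S.Theta⟩

end Signals

/-- `s` is a trajectory on `[t₁, ∞)` of the closed loop: plant with saturated input, reference
model, auxiliary error, and high-order tuner. -/
structure IsClosedLoop {n m : ℕ} (S : MSACData n m) (mode : GainAdaptation)
    (t₁ : ℝ) (s : Signals n m) : Prop where
  cont_r : ContinuousOn s.r (Ici t₁)
  Xi_mem : ∀ t, t₁ ≤ t → mode.proj (s.Xi t) = s.Xi t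
  ThHat_mem : ∀ t, t₁ ≤ t → mode.proj (s.ThHat t) = s.ThHat t
  deriv_xp : ∀ t, t₁ ≤ t → HasDerivWithinAt s.xp
    (S.Ap.mulVec (s.xp t) + S.Bp.mulVec (S.Lam.mulVec (ballSat S.umax (s.u t)))) (Ici t₁) t
  deriv_xm : ∀ t, t₁ ≤ t → HasDerivWithinAt s.xm
    (S.Am.mulVec (s.xm t) + S.Bm.mulVec (s.r t)) (Ici t₁) t
  deriv_eD : ∀ t, t₁ ≤ t → HasDerivWithinAt s.eD
    (S.Am.mulVec (s.eD t) + S.Bp.mulVec ((s.LamHat t).mulVec (s.du S.umax t))) (Ici t₁) t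
  deriv_Xi : ∀ t, t₁ ≤ t → ∀ i j, HasDerivWithinAt (fun τ => s.Xi τ i j)
    (S.tunerRate mode (s.eu t) (s.regressor S.umax t) i j) (Ici t₁) t
  deriv_ThHat : ∀ t, t₁ ≤ t → ∀ i j, HasDerivWithinAt (fun τ => s.ThHat τ i j)
    (-(S.β * (s.ThHat t i j - s.Xi t i j) * S.normalizer (s.regressor S.umax t))) (Ici t₁) t

/-- The error trajectories on `[t₁, ∞)` generated by closed-loop trajectories whose regressor is
bounded by `C` and persistently exciting with constants `T`, `δ₀`, `ε`. -/
def ClosedLoopErr {n m : ℕ} (S : MSACData n m) (mode : GainAdaptation) (C T δ₀ ε : ℝ)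
    (t₁ : ℝ) (z : ℝ → ErrState n m) : Prop :=
  ∃ s : Signals n m, IsClosedLoop S mode t₁ s ∧
    (∀ t, t₁ ≤ t → l2norm (s.regressor S.umax t) ≤ C) ∧
    PersistentlyExcitingWith T δ₀ ε t₁ (s.regressor S.umax) ∧
    z = s.err S

/-- Uniform asymptotic stability of the origin on `[t₀, ∞)` for the family of error trajectories
`Traj t₁ z` ("`z` is a trajectory starting at time `t₁`"): uniform stability together with
uniform attractivity. -/
def UniformlyAsymptoticallyStable {n m : ℕ} (t₀ : ℝ)
    (Traj : ℝ → (ℝ → ErrState n m) → Prop) : Prop :=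
  (∀ η > 0, ∃ δ > 0, ∀ t₁, t₀ ≤ t₁ → ∀ z, Traj t₁ z → (z t₁).size < δ →
    ∀ t, t₁ ≤ t → (z t).size < η) ∧
  (∃ c > 0, ∀ η > 0, ∃ τ > 0, ∀ t₁, t₀ ≤ t₁ → ∀ z, Traj t₁ z → (z t₁).size < c →
    ∀ t, t₁ + τ ≤ t → (z t).size < η)

/-- From initial errors of any prescribed size, the parameter error falls below any prescribed
accuracy within a time depending only on these two numbers, and stays below it. -/
def ReachesAccuracyInFiniteTime {n m : ℕ} (t₀ : ℝ)
    (Traj : ℝ → (ℝ → ErrState n m) → Prop) : Prop :=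
  ∀ ε₁ > 0, ∀ δ > 0, ∃ τ > 0, ∀ t₁, t₀ ≤ t₁ → ∀ z, Traj t₁ z → (z t₁).size ≤ ε₁ →
    ∀ t, t₁ + τ ≤ t → frobNorm (z t).Th ≤ δ

/-! Take V = eᵀPe + (1/γ) Σ w (Ξ² + (Θ̃ - Ξ)²), where Ξ is the tuner error, Θ̃ the parameter error,
and the weights w are λᵢ on the first two blocks and 1 on the last. Along solutions the indefinite
terms of V' couple e only to Θ̃ - Ξ. The normalization absorbs them, and since Q dominates every
weight, V' ≤ -cD with D = ‖e‖² + ‖Θ̃ - Ξ‖² (`Bounds.lyapunovRate_le`).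

This decay does not see Ξ; excitation does (`exists_abs_Xi_le`). Let J be the integral of D over a
window. There Ξ moves by O(√J), so Θ̃ may be replaced by Ξ frozen at the start of the window.
Multiplying the e-equation by a left inverse of `Bp` shows that the integral of Φ against a weighted
row of the frozen Ξ is an increment of e up to O(√J). The increment is itself O(√J) if both
endpoints are moved slightly to times where D is at most its local average. Persistent excitation
then forces Ξ = O(√J).

Hence V at the end of the window is at most K'J, while V has lost at least cJ: it contracts by a
fixed factor (`exists_lyapunov_contraction`). All constants depend only on the data and on C, T, δ₀,
ε, never on Φ, so the regressor may depend on the solution, as it does in the closed loop.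
Definiteness of P comes from the Lyapunov equation through the Cayley transform of `Am`
(`posDef_of_lyapunov`). -/

/-! ### Hurwitz matrices, the Cayley transform and the Lyapunov equation -/

-- By Gelfand's formula, ‖a ^ k‖ is eventually below q ^ k for any q strictly between the spectral
-- radius and 1.
open Filter Topology in
theorem tendsto_pow_of_spectralRadius_lt_one {A : Type*} [NormedRing A] [NormedAlgebra ℂ A]
    [CompleteSpace A] {a : A} (ha : spectralRadius ℂ a < 1) :
    Tendsto (fun k : ℕ => a ^ k) atTop (𝓝 0) := by
  obtain ⟨q, hq, hq1⟩ := exists_between ha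
  have hq_top : q ≠ ⊤ := (hq1.trans ENNReal.one_lt_top).ne
  lift q to NNReal using hq_top
  have hq1' : q < 1 := by exact_mod_cast hq1
  have h := (spectrum.pow_nnnorm_pow_one_div_tendsto_nhds_spectralRadius a).eventually_lt_const hq
  rw [tendsto_zero_iff_norm_tendsto_zero]
  refine squeeze_zero' (Eventually.of_forall fun k => norm_nonneg _) ?_
    (tendsto_pow_atTop_nhds_zero_of_lt_one q.coe_nonneg (by exact_mod_cast hq1'))
  filter_upwards [h, eventually_gt_atTop 0] with k hk hk0
  have hk0' : (0 : ℝ) < k := by exact_mod_cast hk0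
  have h2 := ENNReal.rpow_le_rpow hk.le hk0'.le
  rw [← ENNReal.rpow_mul, one_div, inv_mul_cancel₀ hk0'.ne', ENNReal.rpow_one,
    ENNReal.rpow_natCast] at h2
  exact_mod_cast h2

attribute [local instance] Matrix.linftyOpNormedRing Matrix.linftyOpNormedAlgebra in
open Filter Topology in
theorem Matrix.tendsto_pow_of_spectrum_lt_one {ι : Type*} [Fintype ι] [DecidableEq ι]
    {M : Matrix ι ι ℂ} (hM : ∀ z ∈ spectrum ℂ M, ‖z‖ < 1) :
    Tendsto (fun k : ℕ => M ^ k) atTop (𝓝 0) := by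
  rcases isEmpty_or_nonempty ι with h | h
  · exact tendsto_const_nhds.congr fun k => Subsingleton.elim _ _
  · refine tendsto_pow_of_spectralRadius_lt_one ?_
    exact_mod_cast spectrum.spectralRadius_lt_of_forall_lt (r := 1) M fun z hz => by
      exact_mod_cast hM z hz

namespace IsHurwitz

variable {ι : Type*} [Fintype ι] [DecidableEq ι] {A : Matrix ι ι ℝ}

theorem isUnit_sub (hA : IsHurwitz A) {z : ℂ} (hz : 0 ≤ z.re) :
    IsUnit (z • (1 : Matrix ι ι ℂ) - A.map (algebraMap ℝ ℂ)) := by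
  by_contra h
  exact (hA z (by rwa [spectrum.mem_iff, Algebra.algebraMap_eq_smul_one])).not_ge hz

theorem isUnit_one_sub (hA : IsHurwitz A) : IsUnit (1 - A) := by
  have h := hA.isUnit_sub (z := 1) (by simp)
  have h2 : (1 : ℂ) • (1 : Matrix ι ι ℂ) - A.map (algebraMap ℝ ℂ)
      = (algebraMap ℝ ℂ).mapMatrix (1 - A) := by
    simp [map_sub]
  rw [h2, Matrix.isUnit_iff_isUnit_det, ← RingHom.map_det, isUnit_iff_ne_zero] at h
  rw [Matrix.isUnit_iff_isUnit_det, isUnit_iff_ne_zero]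
  exact fun h0 => h (by rw [h0, map_zero])

/-- Multiplying z - (1 + A)(1 - A)⁻¹ by 1 - A gives (z - 1) - (z + 1)A, a multiple of the resolvent
of A at (z - 1)/(z + 1). For ‖z‖ ≥ 1 that point has nonnegative real part; z = -1, where it is
undefined, leaves the scalar -2. -/
theorem norm_lt_one_of_mem_spectrum_cayley (hA : IsHurwitz A) {z : ℂ}
    (hz : z ∈ spectrum ℂ ((algebraMap ℝ ℂ).mapMatrix ((1 + A) * (1 - A)⁻¹))) : ‖z‖ < 1 := by
  by_contra! h1
  rw [spectrum.mem_iff, Algebra.algebraMap_eq_smul_one] at hz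
  apply hz
  set f := (algebraMap ℝ ℂ).mapMatrix (m := ι)
  have hu : IsUnit (f (1 - A)) := hA.isUnit_one_sub.map f
  have hinv : f (1 - A)⁻¹ * f (1 - A) = 1 := by
    rw [← map_mul, Matrix.nonsing_inv_mul _ ((Matrix.isUnit_iff_isUnit_det _).1 hA.isUnit_one_sub),
      map_one]
  have key : (z • (1 : Matrix ι ι ℂ) - f ((1 + A) * (1 - A)⁻¹)) * f (1 - A)
      = (z - 1) • (1 : Matrix ι ι ℂ) - (z + 1) • f A := by
    rw [map_mul, sub_mul, mul_assoc, hinv, map_sub, map_add, map_one, smul_mul_assoc, one_mul,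
      mul_one]
    module
  suffices h : IsUnit ((z • (1 : Matrix ι ι ℂ) - f ((1 + A) * (1 - A)⁻¹)) * f (1 - A)) by
    have := h.mul hu.unit⁻¹.isUnit
    rwa [mul_assoc, IsUnit.mul_val_inv, mul_one] at this
  rw [key]
  by_cases hz1 : z + 1 = 0
  · have : z - 1 = -2 := by linear_combination hz1
    rw [hz1, this, zero_smul, sub_zero, ← Algebra.algebraMap_eq_smul_one]
    exact (IsUnit.mk0 (-2 : ℂ) (by norm_num)).map _
  · have h3 : (z - 1) • (1 : Matrix ι ι ℂ) - (z + 1) • f A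
        = algebraMap ℂ (Matrix ι ι ℂ) (z + 1) * (((z - 1) / (z + 1)) • 1 - f A) := by
      rw [Algebra.algebraMap_eq_smul_one, smul_mul_assoc, one_mul, smul_sub, smul_smul,
        mul_div_cancel₀ _ hz1]
    rw [h3]
    refine ((IsUnit.mk0 _ hz1).map _).mul (hA.isUnit_sub ?_)
    have h4 : 1 ≤ z.re * z.re + z.im * z.im := by
      rw [← Complex.normSq_apply, Complex.normSq_eq_norm_sq]; nlinarith
    rw [Complex.div_re, ← add_div]
    refine div_nonneg ?_ (Complex.normSq_nonneg _)
    simp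
    nlinarith

open Filter Topology in
theorem tendsto_cayley_pow (hA : IsHurwitz A) :
    Tendsto (fun k : ℕ => ((1 + A) * (1 - A)⁻¹) ^ k) atTop (𝓝 0) := by
  have h := Matrix.tendsto_pow_of_spectrum_lt_one
    (M := (algebraMap ℝ ℂ).mapMatrix ((1 + A) * (1 - A)⁻¹))
    fun z hz => hA.norm_lt_one_of_mem_spectrum_cayley hz
  have hf : Continuous fun M : Matrix ι ι ℂ => M.map Complex.re :=
    continuous_id.matrix_map Complex.continuous_re
  have h2 := (hf.tendsto 0).comp h
  have h0 : (0 : Matrix ι ι ℂ).map Complex.re = 0 := by ext; simp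
  simp only [h0] at h2
  refine h2.congr fun k => ?_
  ext i j
  simp only [Function.comp_apply, ← map_pow]
  simp

-- The Cayley transform turns a Lyapunov equation into a discrete Stein equation, so powers of a
-- matrix can replace integrals of matrix exponentials.
open Matrix in
theorem cayley_stein (hA : IsHurwitz A) (D : Matrix ι ι ℝ) :
    ((1 + A) * (1 - A)⁻¹)ᵀ * D * ((1 + A) * (1 - A)⁻¹)
      = D + (2 : ℝ) • (((1 - A)⁻¹)ᵀ * (Aᵀ * D + D * A) * (1 - A)⁻¹) := by
  have h1 : (1 - A) * (1 - A)⁻¹ = 1 :=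
    Matrix.mul_nonsing_inv _ ((Matrix.isUnit_iff_isUnit_det _).1 hA.isUnit_one_sub)
  have h2 : ((1 - A)⁻¹)ᵀ * (1 - A)ᵀ = 1 := by rw [← transpose_mul, h1, transpose_one]
  set R := (1 - A)⁻¹
  have h3 : D = Rᵀ * ((1 - A)ᵀ * D * (1 - A)) * R := by
    calc D = (Rᵀ * (1 - A)ᵀ) * D * ((1 - A) * R) := by rw [h1, h2, one_mul, mul_one]
      _ = _ := by simp only [mul_assoc]
  have h4 : (1 - A)ᵀ * D * (1 - A) + (2 : ℝ) • (Aᵀ * D + D * A) = (1 + A)ᵀ * D * (1 + A) := by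
    simp only [transpose_sub, transpose_add, transpose_one, sub_mul, add_mul, mul_sub, mul_add,
      one_mul, mul_one]
    module
  conv_rhs => enter [1]; rw [h3]
  rw [← smul_mul_assoc, ← mul_smul_comm, ← add_mul, ← mul_add, h4, transpose_mul]
  simp only [mul_assoc]

-- The form of P decreases along the powers of C and tends to 0, so it is nonnegative; one step of
-- the Stein equation makes it strictly positive. Symmetry holds because P - Pᵀ is unchanged under
-- congruence by C ^ k, which tends to 0.
open Filter Topology Matrix in
theorem posDef_of_lyapunov {P Q : Matrix ι ι ℝ} (hA : IsHurwitz A) (hQ : Q.PosDef)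
    (hP : Aᵀ * P + P * A = -Q) : P.PosDef := by
  set C := (1 + A) * (1 - A)⁻¹ with hC
  have hlim : ∀ D : Matrix ι ι ℝ, Tendsto (fun k : ℕ => (C ^ k)ᵀ * D * C ^ k) atTop (𝓝 0) := by
    intro D
    have hf : Continuous fun M : Matrix ι ι ℝ => Mᵀ * D * M := by fun_prop
    have h := (hf.tendsto 0).comp hA.tendsto_cayley_pow
    simp only [mul_zero] at h
    exact h
  have hQt : Qᵀ = Q := by simpa using hQ.isHermitian.eq
  have hsymm : Pᵀ = P := by
    have h0 : Aᵀ * (P - Pᵀ) + (P - Pᵀ) * A = 0 := by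
      have h1 := congrArg transpose hP
      rw [transpose_add, transpose_mul, transpose_mul, transpose_transpose, transpose_neg, hQt] at h1
      calc _ = (Aᵀ * P + P * A) - (Pᵀ * A + Aᵀ * Pᵀ) := by rw [mul_sub, sub_mul]; abel
        _ = 0 := by rw [hP, h1, sub_self]
    have hinv := hA.cayley_stein (P - Pᵀ)
    rw [h0, mul_zero, zero_mul, smul_zero, add_zero, ← hC] at hinv
    have hk : ∀ k : ℕ, (C ^ k)ᵀ * (P - Pᵀ) * C ^ k = P - Pᵀ := by
      intro k
      induction k with
      | zero => simp
      | succ k ih =>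
        calc _ = (C ^ k)ᵀ * (Cᵀ * (P - Pᵀ) * C) * C ^ k := by
              rw [pow_succ', transpose_mul]; simp only [mul_assoc]
          _ = _ := by rw [hinv, ih]
    have := tendsto_nhds_unique (hlim (P - Pᵀ)) (by simp only [hk]; exact tendsto_const_nhds)
    exact (sub_eq_zero.1 this.symm).symm
  set R := (1 - A)⁻¹ with hR
  have hstein : ∀ x, (C *ᵥ x) ⬝ᵥ P *ᵥ (C *ᵥ x)
      = x ⬝ᵥ P *ᵥ x - 2 * ((R *ᵥ x) ⬝ᵥ Q *ᵥ (R *ᵥ x)) := by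
    intro x
    have h := congrArg (fun M => x ⬝ᵥ M *ᵥ x) (hA.cayley_stein P)
    simp only [hP, ← hC, ← hR, add_mulVec, smul_mulVec, dotProduct_add, dotProduct_smul,
      ← mulVec_mulVec, neg_mulVec, dotProduct_neg,
      dotProduct_mulVec _ Rᵀ, dotProduct_mulVec _ Cᵀ, vecMul_transpose, smul_eq_mul,
      mul_neg, neg_mul] at h
    rw [h]; ring
  have hQ0 : ∀ y, 0 ≤ y ⬝ᵥ Q *ᵥ y := fun y => by
    simpa using hQ.posSemidef.dotProduct_mulVec_nonneg y
  have hnonneg : ∀ x, 0 ≤ x ⬝ᵥ P *ᵥ x := by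
    intro x
    have hle : ∀ k : ℕ, (C ^ k *ᵥ x) ⬝ᵥ P *ᵥ (C ^ k *ᵥ x) ≤ x ⬝ᵥ P *ᵥ x := by
      intro k
      induction k with
      | zero => simp
      | succ k ih =>
        rw [pow_succ', ← mulVec_mulVec, hstein]
        linarith [hQ0 (R *ᵥ (C ^ k *ᵥ x))]
    have hl : Tendsto (fun k : ℕ => (C ^ k *ᵥ x) ⬝ᵥ P *ᵥ (C ^ k *ᵥ x)) atTop (𝓝 0) := by
      have hf : Continuous fun M : Matrix ι ι ℝ => (M *ᵥ x) ⬝ᵥ P *ᵥ (M *ᵥ x) := by fun_prop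
      have h := (hf.tendsto 0).comp hA.tendsto_cayley_pow
      simp only [zero_mulVec, zero_dotProduct] at h
      exact h
    exact le_of_tendsto' hl hle
  refine PosDef.of_dotProduct_mulVec_pos (by simpa [IsHermitian] using hsymm) fun x hx => ?_
  have h1 := hnonneg (C *ᵥ x)
  have hRx : R *ᵥ x ≠ 0 := by
    intro h0
    apply hx
    have h2 : (1 - A) * R = 1 :=
      Matrix.mul_nonsing_inv _ ((Matrix.isUnit_iff_isUnit_det _).1 hA.isUnit_one_sub)
    rw [← one_mulVec x, ← h2, ← mulVec_mulVec, h0, mulVec_zero]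
  have h2 := hQ.dotProduct_mulVec_pos hRx
  simp only [star_trivial] at h2 ⊢
  rw [hstein] at h1
  linarith

end IsHurwitz

/-! ### Left inverses, quadratic forms and norms -/

open Matrix in
theorem Matrix.exists_leftInverse_of_rank_eq {m n : ℕ} {B : Matrix (Fin n) (Fin m) ℝ}
    (h : B.rank = m) : ∃ L : Matrix (Fin m) (Fin n) ℝ, L * B = 1 := by
  have hr : (Bᵀ * B).rank = m := by rw [rank_transpose_mul_self, h]
  have hu : IsUnit (Bᵀ * B) := by
    rw [← Matrix.linearIndependent_cols_iff_isUnit, linearIndependent_iff_card_eq_finrank_span,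
      Fintype.card_fin, Set.finrank, ← Matrix.rank_eq_finrank_span_cols, hr]
  refine ⟨(Bᵀ * B)⁻¹ * Bᵀ, ?_⟩
  rw [Matrix.mul_assoc, nonsing_inv_mul _ ((isUnit_iff_isUnit_det _).1 hu)]

/-- A continuous function homogeneous of degree two and positive off the origin dominates a
multiple of the squared norm. -/
theorem exists_mul_sq_le_of_homogeneous {E : Type*} [NormedAddCommGroup E] [NormedSpace ℝ E]
    [FiniteDimensional ℝ E] {f : E → ℝ} (hf : Continuous f)
    (hom : ∀ (c : ℝ) x, f (c • x) = c ^ 2 * f x) (hpos : ∀ x, x ≠ 0 → 0 < f x) :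
    ∃ c > 0, ∀ x, c * ‖x‖ ^ 2 ≤ f x := by
  have : ProperSpace E := FiniteDimensional.proper ℝ E
  have h0 : f 0 = 0 := by simpa using hom 0 0
  rcases (Metric.sphere (0 : E) 1).eq_empty_or_nonempty with he | hne
  · refine ⟨1, one_pos, fun x => ?_⟩
    have hx : x = 0 := by
      by_contra hx
      have : ‖x‖⁻¹ • x ∈ Metric.sphere (0 : E) 1 := by
        simp [norm_smul, norm_ne_zero_iff.2 hx]
      simp [he] at this
    simp [hx, h0]
  · obtain ⟨y, hy, hmin⟩ := (isCompact_sphere (0 : E) 1).exists_isMinOn hne hf.continuousOn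
    have hy1 : ‖y‖ = 1 := by simpa using hy
    refine ⟨f y, hpos y (fun h => by simp [h] at hy1), fun x => ?_⟩
    by_cases hx : x = 0
    · simp [hx, h0]
    have hx' : ‖x‖ ≠ 0 := norm_ne_zero_iff.2 hx
    have hm : f y ≤ f (‖x‖⁻¹ • x) := hmin (by simp [norm_smul, hx'])
    rw [hom, inv_pow, inv_mul_eq_div, le_div_iff₀ (by positivity)] at hm
    exact hm

section Norms

variable {ι κ : Type*} [Fintype ι] [Fintype κ]

theorem l2norm_nonneg (v : ι → ℝ) : 0 ≤ l2norm v := norm_nonneg _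

theorem l2norm_sq (v : ι → ℝ) : l2norm v ^ 2 = ∑ i, v i ^ 2 := by
  simp [l2norm, EuclideanSpace.norm_sq_eq]

theorem l2norm_smul (c : ℝ) (v : ι → ℝ) : l2norm (c • v) = |c| * l2norm v := by
  simp [l2norm, norm_smul]

theorem l2norm_sq_eq_dotProduct (v : ι → ℝ) : l2norm v ^ 2 = v ⬝ᵥ v := by
  rw [l2norm_sq]
  exact Finset.sum_congr rfl fun i _ => pow_two _

theorem abs_apply_le_l2norm (v : ι → ℝ) (i : ι) : |v i| ≤ l2norm v := by
  refine abs_le_of_sq_le_sq ?_ (l2norm_nonneg v)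
  rw [l2norm_sq]
  exact Finset.single_le_sum (f := fun i => v i ^ 2) (fun i _ => sq_nonneg _) (Finset.mem_univ i)

theorem abs_dotProduct_le (v w : ι → ℝ) : |v ⬝ᵥ w| ≤ l2norm v * l2norm w := by
  refine abs_le_of_sq_le_sq ?_ (mul_nonneg (l2norm_nonneg _) (l2norm_nonneg _))
  rw [mul_pow, l2norm_sq, l2norm_sq]
  exact Finset.sum_mul_sq_le_sq_mul_sq _ _ _

theorem frobNorm_nonneg (M : Matrix ι κ ℝ) : 0 ≤ frobNorm M := l2norm_nonneg _

theorem frobNorm_sq (M : Matrix ι κ ℝ) : frobNorm M ^ 2 = ∑ i, ∑ j, M i j ^ 2 := by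
  rw [frobNorm, l2norm_sq, Fintype.sum_prod_type]

theorem abs_apply_le_frobNorm (M : Matrix ι κ ℝ) (i : ι) (j : κ) : |M i j| ≤ frobNorm M :=
  abs_apply_le_l2norm (fun p : ι × κ => M p.1 p.2) (i, j)

theorem frobNorm_transpose (M : Matrix ι κ ℝ) : frobNorm M.transpose = frobNorm M := by
  refine (pow_left_inj₀ (frobNorm_nonneg _) (frobNorm_nonneg _) two_ne_zero).1 ?_
  rw [frobNorm_sq, frobNorm_sq, Finset.sum_comm]
  rfl

theorem l2norm_mulVec_le (M : Matrix ι κ ℝ) (v : κ → ℝ) :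
    l2norm (M.mulVec v) ≤ frobNorm M * l2norm v := by
  refine le_of_sq_le_sq ?_ (mul_nonneg (frobNorm_nonneg _) (l2norm_nonneg _))
  rw [l2norm_sq, mul_pow, frobNorm_sq, Finset.sum_mul]
  refine Finset.sum_le_sum fun i _ => ?_
  rw [l2norm_sq]
  exact Finset.sum_mul_sq_le_sq_mul_sq _ _ _

theorem continuous_l2norm : Continuous (l2norm : (ι → ℝ) → ℝ) :=
  (PiLp.continuous_toLp 2 _).norm

theorem Matrix.PosDef.exists_mul_l2norm_sq_le {M : Matrix ι ι ℝ} (hM : M.PosDef) :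
    ∃ c > 0, ∀ v : ι → ℝ, c * l2norm v ^ 2 ≤ v ⬝ᵥ M.mulVec v := by
  obtain ⟨c, hc, h⟩ := exists_mul_sq_le_of_homogeneous (E := EuclideanSpace ℝ ι)
    (f := fun v => v.ofLp ⬝ᵥ M.mulVec v.ofLp) (by fun_prop)
    (fun c x => by simp [Matrix.mulVec_smul]; ring)
    (fun x hx => by
      have := hM.dotProduct_mulVec_pos (x := x.ofLp) (by simpa using hx)
      simpa using this)
  exact ⟨c, hc, fun v => h (WithLp.toLp 2 v)⟩

end Norms

/-! ### Adapted entries, the Lyapunov function and its decay -/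

namespace GainAdaptation

variable {n m : ℕ} (mode : GainAdaptation)

/-- The indicator of the adapted entries. -/
noncomputable def mask (i : Fin m) : RegIdx n m → ℝ :=
  match mode with
  | .full => fun _ => 1
  | .diagonal => Sum.elim (fun _ => 1) (Sum.elim (fun _ => 1) (fun j => if i = j then 1 else 0))

theorem proj_apply (M : ParamMatrix n m) (i : Fin m) (j : RegIdx n m) :
    mode.proj M i j = mode.mask i j * M i j := by
  cases mode
  · simp [proj, mask]
  · rcases j with j | j | j <;> simp [proj, mask]

theorem abs_mask_le (i : Fin m) (j : RegIdx n m) : |mode.mask i j| ≤ 1 := by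
  cases mode
  · simp [mask]
  · rcases j with j | j | j <;> simp [mask]
    split_ifs <;> simp

theorem mul_mask {M : ParamMatrix n m} (h : mode.proj M = M) (i : Fin m) (j : RegIdx n m) :
    M i j * mode.mask i j = M i j := by
  conv_rhs => rw [← h, proj_apply]
  ring

end GainAdaptation

namespace MSACData

variable {n m : ℕ} (S : MSACData n m)

/-- The weight of each parameter error in the error equation. -/
def weight (i : Fin m) : RegIdx n m → ℝ :=
  Sum.elim (fun _ => S.lam i) (Sum.elim (fun _ => S.lam i) (fun _ => 1))

theorem scaled_apply (M : ParamMatrix n m) (i : Fin m) (j : RegIdx n m) :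
    S.scaled M i j = S.weight i j * M i j := by
  rcases j with j | j | j <;> simp [scaled, weight]

theorem tunerRate_apply (mode : GainAdaptation) (e : Fin n → ℝ) (φ : RegIdx n m → ℝ)
    (i : Fin m) (j : RegIdx n m) :
    S.tunerRate mode e φ i j
      = -(S.γ * (mode.mask i j * (S.Bp.transpose.mulVec (S.P.mulVec e) i * φ j))) := by
  rw [tunerRate, GainAdaptation.proj_apply]
  simp [Matrix.vecMulVec_apply]
  ring

/-- The Lyapunov function of the adaptive error system. -/
noncomputable def lyapunov (z : ErrState n m) : ℝ :=
  z.e ⬝ᵥ S.P.mulVec z.e +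
    1 / S.γ * ∑ i, ∑ j, S.weight i j * (z.Xi i j ^ 2 + (z.Th i j - z.Xi i j) ^ 2)

/-- The standing assumptions in quantitative form. -/
structure Bounds (p L w : ℝ) : Prop where
  p_pos : 0 < p
  L_pos : 0 < L
  w_pos : 0 < w
  gain_pos : 0 < S.γ
  rate_pos : 0 < S.β
  P_symm : S.P.transpose = S.P
  lyapunov_eq : S.Am.transpose * S.P + S.P * S.Am = -S.Q
  P_ge : ∀ e, p * l2norm e ^ 2 ≤ e ⬝ᵥ S.P.mulVec e
  Q_ge : ∀ e, L * l2norm e ^ 2 ≤ e ⬝ᵥ S.Q.mulVec e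
  le_weight : ∀ i j, w ≤ S.weight i j
  weight_le : ∀ i j, S.weight i j ≤ L
  normalization : 2 * S.γ / S.β * frobNorm (S.P * S.Bp) ^ 2 ≤ S.μ

/-- The same L must bound Q from below and the weights from above. The largest max(1, λᵢ) does both,
by the assumption on Q. -/
theorem exists_bounds (hlam : ∀ i, 0 < S.lam i) (hAm : IsHurwitz S.Am) (hQ : S.Q.PosDef)
    (hP : S.Am.transpose * S.P + S.P * S.Am = -S.Q)
    (hQlam : ∀ i, (S.Q - max 1 (S.lam i) • (1 : Matrix (Fin n) (Fin n) ℝ)).PosSemidef)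
    (hγ : 0 < S.γ) (hβ : 0 < S.β)
    (hμ : 2 * S.γ / S.β * frobNorm (S.P * S.Bp) ^ 2 ≤ S.μ) :
    ∃ p L w, S.Bounds p L w := by
  have hPd := hAm.posDef_of_lyapunov hQ hP
  obtain ⟨p, hp, hp'⟩ := hPd.exists_mul_l2norm_sq_le
  obtain ⟨L, hL, hQL, hLl⟩ : ∃ L > 0, (∀ e, L * l2norm e ^ 2 ≤ e ⬝ᵥ S.Q.mulVec e) ∧
      ∀ i, max 1 (S.lam i) ≤ L := by
    -- With m = 0 there are no weights to bound, and L comes from the definiteness of Q alone.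
    rcases isEmpty_or_nonempty (Fin m) with h | h
    · obtain ⟨L, hL, hL'⟩ := hQ.exists_mul_l2norm_sq_le
      exact ⟨L, hL, hL', fun i => h.elim i⟩
    · obtain ⟨i, hi⟩ := Finite.exists_max fun i => max 1 (S.lam i)
      refine ⟨max 1 (S.lam i), by positivity, fun e => ?_, hi⟩
      have := (hQlam i).dotProduct_mulVec_nonneg e
      rw [l2norm_sq_eq_dotProduct]
      simpa [Matrix.sub_mulVec, Matrix.smul_mulVec] using this
  obtain ⟨w, hw, hw1, hwl⟩ : ∃ w > 0, w ≤ 1 ∧ ∀ i, w ≤ S.lam i := by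
    rcases isEmpty_or_nonempty (Fin m) with h | h
    · exact ⟨1, one_pos, le_rfl, fun i => h.elim i⟩
    · obtain ⟨i, hi⟩ := Finite.exists_min fun i => S.lam i
      exact ⟨min 1 (S.lam i), lt_min one_pos (hlam i), min_le_left _ _,
        fun j => (min_le_right _ _).trans (hi j)⟩
  refine ⟨p, L, w, hp, hL, hw, hγ, hβ, by simpa using hPd.isHermitian.eq, hP, hp', hQL, ?_, ?_, hμ⟩
  · rintro i (j | j | j) <;> simp [weight, hw1, hwl]
  · rintro i (j | j | j)
    · exact (le_max_right _ _).trans (hLl i)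
    · exact (le_max_right _ _).trans (hLl i)
    · exact (le_max_left _ _).trans (hLl i)

end MSACData

/-- The squared norm of the error coordinates dissipated by the Lyapunov function. -/
noncomputable def ErrState.dissipated {n m : ℕ} (z : ErrState n m) : ℝ :=
  l2norm z.e ^ 2 + frobNorm (z.Th - z.Xi) ^ 2

namespace MSACData

variable {n m : ℕ} {S : MSACData n m} {p L w : ℝ}

/-- The derivative of the Lyapunov function along solutions driven by `φ`. -/
noncomputable def lyapunovRate (S : MSACData n m) (z : ErrState n m) (φ : RegIdx n m → ℝ) : ℝ :=
  -(z.e ⬝ᵥ S.Q.mulVec z.e) + ∑ i, ∑ j, S.weight i j *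
    (4 * (z.Th i j - z.Xi i j) * (S.Bp.transpose.mulVec (S.P.mulVec z.e) i * φ j)
      - 2 * S.β / S.γ * S.normalizer φ * (z.Th i j - z.Xi i j) ^ 2)

theorem Bounds.l2norm_output_le (h : S.Bounds p L w) (e : Fin n → ℝ) :
    l2norm (S.Bp.transpose.mulVec (S.P.mulVec e)) ≤ frobNorm (S.P * S.Bp) * l2norm e := by
  have : S.Bp.transpose.mulVec (S.P.mulVec e) = (S.P * S.Bp).transpose.mulVec e := by
    rw [Matrix.mulVec_mulVec, Matrix.transpose_mul, h.P_symm]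
  rw [this, ← frobNorm_transpose]
  exact l2norm_mulVec_le _ _

/-- Young's inequality with parameter k = 1/(F²f + s), where f = ‖φ‖², splits each cross term. The
e-part sums to at most L(1 - sk)‖e‖², just below what Q provides; the other part is covered by the
normalization. -/
theorem Bounds.lyapunovRate_le (h : S.Bounds p L w) (C : ℝ) :
    ∃ c > 0, ∀ z φ, l2norm φ ≤ C → S.lyapunovRate z φ ≤ -(c * z.dissipated) := by
  have hγ := h.gain_pos
  have hβ := h.rate_pos
  have hL := h.L_pos
  have hw := h.w_pos
  set F := frobNorm (S.P * S.Bp)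
  -- The constant 1 in the normalizer contributes 2β/γ. Half of it is 4s, the slack that keeps decay
  -- in e; the other half keeps decay in Θ̃ - Ξ.
  set s := S.β / (4 * S.γ) with hs
  have hs0 : 0 < s := by positivity
  refine ⟨min (s / (F ^ 2 * C ^ 2 + s) * L) (S.β / S.γ * w), by positivity, fun z φ hφ => ?_⟩
  set b := S.Bp.transpose.mulVec (S.P.mulVec z.e) with hb
  have hb2 : ∑ i, b i ^ 2 ≤ F ^ 2 * l2norm z.e ^ 2 := by
    rw [← l2norm_sq, ← mul_pow]
    exact pow_le_pow_left₀ (l2norm_nonneg _) (h.l2norm_output_le z.e) 2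
  set f := l2norm φ ^ 2 with hf
  have hf0 : 0 ≤ f := sq_nonneg _
  have hfC : f ≤ C ^ 2 := pow_le_pow_left₀ (l2norm_nonneg _) hφ 2
  set k := 1 / (F ^ 2 * f + s) with hk
  have hk0 : 0 < k := by positivity
  have hkf : k * (F ^ 2 * f) = 1 - s * k := by rw [hk]; field_simp; ring
  have hsk : s / (F ^ 2 * C ^ 2 + s) ≤ s * k := by
    rw [hk, mul_one_div]
    gcongr
  have hN : 4 * (F ^ 2 * f + s) + S.β / S.γ ≤ 2 * S.β / S.γ * S.normalizer φ := by
    have h1 : 4 * F ^ 2 ≤ 2 * S.β / S.γ * S.μ := by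
      have := mul_le_mul_of_nonneg_left h.normalization
        (show 0 ≤ 2 * S.β / S.γ by positivity)
      refine le_trans (le_of_eq ?_) this
      field_simp; ring
    rw [normalizer, ← l2norm_sq_eq_dotProduct, ← hf]
    have h2 : 4 * s = S.β / S.γ := by rw [hs]; field_simp
    have h3 : 2 * S.β / S.γ = S.β / S.γ + S.β / S.γ := by ring
    nlinarith [mul_le_mul_of_nonneg_right h1 hf0]
  have hterm : ∀ i j, S.weight i j * (4 * (z.Th i j - z.Xi i j) * (b i * φ j)
      - 2 * S.β / S.γ * S.normalizer φ * (z.Th i j - z.Xi i j) ^ 2)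
      ≤ L * k * (b i ^ 2 * φ j ^ 2) - S.β / S.γ * w * (z.Th i j - z.Xi i j) ^ 2 := by
    intro i j
    set d := z.Th i j - z.Xi i j
    have hw0 := h.w_pos.trans_le (h.le_weight i j)
    have hyoung : 4 * d * (b i * φ j) ≤ k * (b i * φ j) ^ 2 + 4 * (F ^ 2 * f + s) * d ^ 2 := by
      have h1 : k * (F ^ 2 * f + s) = 1 := by rw [hk]; field_simp
      have h2 : 0 ≤ k * (b i * φ j - 2 * (F ^ 2 * f + s) * d) ^ 2 := by positivity
      have h3 : k * (b i * φ j - 2 * (F ^ 2 * f + s) * d) ^ 2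
          = k * (b i * φ j) ^ 2 - 4 * (k * (F ^ 2 * f + s)) * d * (b i * φ j)
            + 4 * (k * (F ^ 2 * f + s)) * (F ^ 2 * f + s) * d ^ 2 := by ring
      rw [h3, h1] at h2
      linarith
    have h1 : 4 * d * (b i * φ j) - 2 * S.β / S.γ * S.normalizer φ * d ^ 2
        ≤ k * (b i * φ j) ^ 2 - S.β / S.γ * d ^ 2 := by
      nlinarith [mul_le_mul_of_nonneg_right hN (sq_nonneg d)]
    calc _ ≤ S.weight i j * (k * (b i * φ j) ^ 2 - S.β / S.γ * d ^ 2) :=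
          mul_le_mul_of_nonneg_left h1 hw0.le
      _ = S.weight i j * (k * (b i * φ j) ^ 2) - S.weight i j * (S.β / S.γ * d ^ 2) := by ring
      _ ≤ L * (k * (b i * φ j) ^ 2) - w * (S.β / S.γ * d ^ 2) :=
          sub_le_sub (mul_le_mul_of_nonneg_right (h.weight_le i j) (by positivity))
            (mul_le_mul_of_nonneg_right (h.le_weight i j) (by positivity))
      _ = _ := by ring
  have hsum : S.lyapunovRate z φ ≤ -(L * l2norm z.e ^ 2) + (L * k * ((∑ i, b i ^ 2) * f)
      - S.β / S.γ * w * frobNorm (z.Th - z.Xi) ^ 2) := by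
    refine add_le_add (neg_le_neg (h.Q_ge z.e)) ?_
    refine (Finset.sum_le_sum fun i _ => Finset.sum_le_sum fun j _ => hterm i j).trans_eq ?_
    simp only [Finset.sum_sub_distrib, ← Finset.mul_sum, frobNorm_sq, hf, l2norm_sq,
      Finset.sum_mul, Matrix.sub_apply]
  have he : 0 ≤ l2norm z.e ^ 2 := sq_nonneg _
  have h1 : L * k * ((∑ i, b i ^ 2) * f) ≤ L * l2norm z.e ^ 2 - s * k * L * l2norm z.e ^ 2 := by
    calc _ ≤ L * k * (F ^ 2 * l2norm z.e ^ 2 * f) := by gcongr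
      _ = L * l2norm z.e ^ 2 * (k * (F ^ 2 * f)) := by ring
      _ = _ := by rw [hkf]; ring
  have h2 : min (s / (F ^ 2 * C ^ 2 + s) * L) (S.β / S.γ * w) * l2norm z.e ^ 2
      ≤ s * k * L * l2norm z.e ^ 2 :=
    mul_le_mul_of_nonneg_right ((min_le_left _ _).trans
      (mul_le_mul_of_nonneg_right hsk hL.le)) he
  have h3 : min (s / (F ^ 2 * C ^ 2 + s) * L) (S.β / S.γ * w) * frobNorm (z.Th - z.Xi) ^ 2
      ≤ S.β / S.γ * w * frobNorm (z.Th - z.Xi) ^ 2 :=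
    mul_le_mul_of_nonneg_right (min_le_right _ _) (sq_nonneg _)
  rw [ErrState.dissipated, mul_add]
  linarith

end MSACData

namespace IsErrorSolution

variable {n m : ℕ} {S : MSACData n m} {mode : GainAdaptation} {Φ : ℝ → RegIdx n m → ℝ}
  {t₁ : ℝ} {z : ℝ → ErrState n m} {p L w : ℝ}

-- The e-equation contributes 2bwΘ̃φ and the tuner contributes -2bwΞφ + 2bw(Θ̃ - Ξ)φ, together
-- 4bw(Θ̃ - Ξ)φ. The weights match the scaling of the parameter error in the e-equation. Masks
-- disappear because both errors are supported on adapted entries.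
open Matrix in
theorem hasDerivWithinAt_lyapunov (hz : IsErrorSolution S mode Φ t₁ z) (h : S.Bounds p L w)
    {t : ℝ} (ht : t₁ ≤ t) :
    HasDerivWithinAt (fun s => S.lyapunov (z s)) (S.lyapunovRate (z t) (Φ t)) (Ici t₁) t := by
  have he := hasDerivWithinAt_pi.1 (hz.deriv_e t ht)
  have hX := hz.deriv_Xi t ht
  have hT := hz.deriv_Th t ht
  set e' := S.Am.mulVec (z t).e + S.Bp.mulVec ((S.scaled (z t).Th).mulVec (Φ t)) with he'
  set b := S.Bp.transpose.mulVec (S.P.mulVec (z t).e) with hb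
  have hquad : HasDerivWithinAt (fun s => (z s).e ⬝ᵥ S.P.mulVec (z s).e)
      (∑ i, (e' i * (S.P.mulVec (z t).e) i + (z t).e i * (S.P.mulVec e') i)) (Ici t₁) t := by
    have hPe : ∀ i, HasDerivWithinAt (fun s => (S.P.mulVec (z s).e) i) ((S.P.mulVec e') i)
        (Ici t₁) t := fun i =>
      HasDerivWithinAt.fun_sum (u := Finset.univ) fun j _ => (he j).const_mul (S.P i j)
    exact HasDerivWithinAt.fun_sum fun i _ => (he i).mul (hPe i)
  have hsum := (HasDerivWithinAt.fun_sum (u := Finset.univ) fun i _ =>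
    HasDerivWithinAt.fun_sum (u := Finset.univ) fun j _ =>
    ((((hX i j).pow 2).add (((hT i j).sub (hX i j)).pow 2)).const_mul (S.weight i j))).const_mul
    (1 / S.γ)
  have hγ := h.gain_pos
  refine (hquad.add hsum).congr_deriv ?_
  have hq : ∑ i, (e' i * (S.P.mulVec (z t).e) i + (z t).e i * (S.P.mulVec e') i)
      = -((z t).e ⬝ᵥ S.Q.mulVec (z t).e)
        + ∑ i, ∑ j, 2 * (b i * (S.weight i j * (z t).Th i j * Φ t j)) := by
    have h1 : (z t).e ⬝ᵥ S.P *ᵥ e' = e' ⬝ᵥ S.P *ᵥ (z t).e := by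
      rw [dotProduct_mulVec, ← mulVec_transpose, h.P_symm, dotProduct_comm]
    have h2 : (S.Am *ᵥ (z t).e) ⬝ᵥ S.P *ᵥ (z t).e + (S.Am *ᵥ (z t).e) ⬝ᵥ S.P *ᵥ (z t).e
        = -((z t).e ⬝ᵥ S.Q *ᵥ (z t).e) := by
      have h3 := congrArg (fun M => (z t).e ⬝ᵥ M *ᵥ (z t).e) h.lyapunov_eq
      simp only [add_mulVec, dotProduct_add, ← mulVec_mulVec, neg_mulVec, dotProduct_neg] at h3
      rw [← h3]
      congr 1
      · rw [dotProduct_mulVec _ S.Amᵀ, vecMul_transpose]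
      · rw [dotProduct_mulVec _ S.P, ← mulVec_transpose, h.P_symm, dotProduct_comm]
    have h4 : (S.Bp *ᵥ (S.scaled (z t).Th *ᵥ Φ t)) ⬝ᵥ S.P *ᵥ (z t).e
        = ∑ i, ∑ j, b i * (S.weight i j * (z t).Th i j * Φ t j) := by
      rw [dotProduct_comm, dotProduct_mulVec, ← mulVec_transpose, ← hb]
      simp only [dotProduct, mulVec, Finset.mul_sum, S.scaled_apply]
    rw [Finset.sum_add_distrib]
    change e' ⬝ᵥ S.P *ᵥ (z t).e + (z t).e ⬝ᵥ S.P *ᵥ e' = _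
    simp only [← Finset.mul_sum] at h4 ⊢
    rw [h1, he', add_dotProduct, h4]
    linarith
  rw [hq, MSACData.lyapunovRate, add_assoc, Finset.mul_sum, ← Finset.sum_add_distrib]
  congr 1
  refine Finset.sum_congr rfl fun i _ => ?_
  rw [Finset.mul_sum, ← Finset.sum_add_distrib]
  refine Finset.sum_congr rfl fun j _ => ?_
  have m1 := mode.mul_mask (hz.Xi_mem t ht) i j
  have m2 := mode.mul_mask (hz.Th_mem t ht) i j
  rw [S.tunerRate_apply, ← hb]
  simp only [Nat.cast_ofNat, Nat.add_one_sub_one, pow_one, Pi.sub_apply]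
  field_simp
  linear_combination (2 * S.γ * S.weight i j * b i * Φ t j) * m2
    - (4 * S.γ * S.weight i j * b i * Φ t j) * m1

end IsErrorSolution

/-! ### Integral estimates -/

section Integrals

variable {a b : ℝ}

theorem exists_mul_le_integral {f : ℝ → ℝ} (hab : a ≤ b) (hf : ContinuousOn f (Icc a b)) :
    ∃ x ∈ Icc a b, (b - a) * f x ≤ ∫ τ in a..b, f τ := by
  obtain ⟨x, hx, hmin⟩ := isCompact_Icc.exists_isMinOn (nonempty_Icc.2 hab) hf
  refine ⟨x, hx, ?_⟩
  have := intervalIntegral.integral_mono_on hab (g := f) (f := fun _ => f x)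
    (μ := MeasureTheory.volume) intervalIntegrable_const
    (hf.intervalIntegrable_of_Icc hab) fun τ hτ => hmin hτ
  simpa using this

theorem sq_integral_le {f : ℝ → ℝ} (hab : a ≤ b) (hf : ContinuousOn f (Icc a b)) :
    (∫ τ in a..b, f τ) ^ 2 ≤ (b - a) * ∫ τ in a..b, f τ ^ 2 := by
  rcases hab.eq_or_lt with rfl | hlt
  · simp
  set I := ∫ τ in a..b, f τ with hI
  have hfi := hf.intervalIntegrable_of_Icc (μ := MeasureTheory.volume) hab
  have hf2 := (hf.pow 2).intervalIntegrable_of_Icc (μ := MeasureTheory.volume) hab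
  have hd : 0 < b - a := sub_pos.2 hlt
  -- Cauchy–Schwarz against the constant 1, from the nonnegative square of f minus its mean.
  have h : ∫ τ in a..b, (2 * (I / (b - a)) * f τ - (I / (b - a)) ^ 2) ≤ ∫ τ in a..b, f τ ^ 2 := by
    refine intervalIntegral.integral_mono_on hab ((hfi.const_mul _).sub (by simp)) hf2
      fun τ _ => ?_
    nlinarith [sq_nonneg (f τ - I / (b - a))]
  rw [intervalIntegral.integral_sub (hfi.const_mul _) (by simp),
    intervalIntegral.integral_const_mul, ← hI, intervalIntegral.integral_const, smul_eq_mul] at h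
  have h2 : 2 * (I / (b - a)) * I - (b - a) * (I / (b - a)) ^ 2 = I ^ 2 / (b - a) := by
    field_simp; ring
  rw [h2, div_le_iff₀ hd] at h
  linarith

/-- Comparing the right derivative with f + N and f - N means only f and N are ever integrated; no
integrability of g' is needed. -/
theorem abs_sub_sub_integral_le {g g' f N : ℝ → ℝ} (hab : a ≤ b) (hg : ContinuousOn g (Icc a b))
    (hderiv : ∀ x ∈ Ioo a b, HasDerivWithinAt g (g' x) (Ioi x) x)
    (hf : ContinuousOn f (Icc a b)) (hN : ContinuousOn N (Icc a b))
    (hle : ∀ x ∈ Ioo a b, |g' x - f x| ≤ N x) :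
    |g b - g a - ∫ τ in a..b, f τ| ≤ ∫ τ in a..b, N τ := by
  have hfi := hf.intervalIntegrable_of_Icc (μ := MeasureTheory.volume) hab
  have hNi := hN.intervalIntegrable_of_Icc (μ := MeasureTheory.volume) hab
  have h1 := intervalIntegral.sub_le_integral_of_hasDeriv_right_of_le hab hg hderiv
    (φ := fun x => f x + N x) (hf.add hN).integrableOn_Icc
    fun x hx => by linarith [(abs_le.1 (hle x hx)).2]
  have h2 := intervalIntegral.sub_le_integral_of_hasDeriv_right_of_le hab hg.neg
    (fun x hx => (hderiv x hx).neg)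
    (φ := fun x => -f x + N x) (hf.neg.add hN).integrableOn_Icc
    fun x hx => by linarith [(abs_le.1 (hle x hx)).1]
  rw [intervalIntegral.integral_add hfi hNi] at h1
  rw [intervalIntegral.integral_add (f := fun x => -f x) hfi.neg hNi,
    intervalIntegral.integral_neg] at h2
  simp only [Pi.neg_apply] at h2
  rw [abs_le]
  constructor <;> linarith

theorem integral_le_integral_of_subinterval {f : ℝ → ℝ} {c d : ℝ} (hca : c ≤ a) (hab : a ≤ b)
    (hbd : b ≤ d) (hf : ContinuousOn f (Icc c d)) (h0 : ∀ x, 0 ≤ f x) :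
    ∫ τ in a..b, f τ ≤ ∫ τ in c..d, f τ :=
  intervalIntegral.integral_mono_interval hca hab hbd (Filter.Eventually.of_forall h0)
    (hf.intervalIntegrable_of_Icc (hca.trans (hab.trans hbd)))

/-- Perturbing the endpoints of an integral of a bounded function. -/
theorem abs_integral_sub_integral_le {f : ℝ → ℝ} {a' b' C s r : ℝ}
    (hs : ∀ x, s ≤ x → |f x| ≤ C) (hf : ContinuousOn f (Ici s))
    (ha : s ≤ a) (hb : s ≤ b) (haa' : a ∈ Icc a' (a' + r)) (hbb' : b ∈ Icc b' (b' + r))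
    (ha' : s ≤ a') (hb' : s ≤ b') :
    |(∫ τ in a..b, f τ) - ∫ τ in a'..b', f τ| ≤ 2 * C * r := by
  have hint : ∀ {x y}, s ≤ x → s ≤ y → IntervalIntegrable f MeasureTheory.volume x y :=
    fun hx hy => (hf.mono fun τ hτ => (le_inf hx hy).trans hτ.1).intervalIntegrable
  have hC : 0 ≤ C := (abs_nonneg _).trans (hs s le_rfl)
  have hbound : ∀ {x y}, s ≤ x → y ∈ Icc x (x + r) → |∫ τ in x..y, f τ| ≤ C * r := by
    intro x y hx hy
    have := intervalIntegral.norm_integral_le_of_norm_le_const (a := x) (b := y) (f := f) (C := C)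
      fun τ hτ => hs τ (by rw [uIoc_of_le hy.1] at hτ; exact hx.trans hτ.1.le)
    rw [abs_of_nonneg (sub_nonneg.2 hy.1)] at this
    exact this.trans (mul_le_mul_of_nonneg_left (by linarith [hy.2]) hC)
  have h1 := intervalIntegral.integral_add_adjacent_intervals (hint ha' ha) (hint ha hb)
  have h2 := intervalIntegral.integral_add_adjacent_intervals (hint ha' hb') (hint hb' hb)
  have e : (∫ τ in a..b, f τ) - ∫ τ in a'..b', f τ = (∫ τ in b'..b, f τ) - ∫ τ in a'..a, f τ := by
    linarith
  rw [e]
  have := abs_sub (∫ τ in b'..b, f τ) (∫ τ in a'..a, f τ)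
  linarith [hbound ha' haa', hbound hb' hbb']

end Integrals

/-! ### Persistent excitation and recovery of the tuner error -/

theorem ErrState.dissipated_nonneg {n m : ℕ} (z : ErrState n m) : 0 ≤ z.dissipated := by
  unfold ErrState.dissipated; positivity

theorem ErrState.l2norm_e_le {n m : ℕ} (z : ErrState n m) :
    l2norm z.e ≤ Real.sqrt z.dissipated :=
  Real.le_sqrt_of_sq_le (le_add_of_nonneg_right (sq_nonneg _))

theorem ErrState.abs_Th_sub_Xi_le {n m : ℕ} (z : ErrState n m) (i : Fin m) (j : RegIdx n m) :
    |z.Th i j - z.Xi i j| ≤ Real.sqrt z.dissipated :=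
  (abs_apply_le_frobNorm (z.Th - z.Xi) i j).trans
    (Real.le_sqrt_of_sq_le (le_add_of_nonneg_left (sq_nonneg _)))

/-- A continuous regressor on `[t₁, ∞)` bounded by `C` and persistently exciting with
prescribed constants. -/
structure IsExcitingRegressor {ι : Type*} [Fintype ι] (C T δ₀ ε t₁ : ℝ) (Φ : ℝ → ι → ℝ) :
    Prop where
  cont : ContinuousOn Φ (Ici t₁)
  bound : ∀ t, t₁ ≤ t → l2norm (Φ t) ≤ C
  exciting : PersistentlyExcitingWith T δ₀ ε t₁ Φ

/-- Persistent excitation survives small perturbations of the endpoints of the subwindow. -/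
theorem IsExcitingRegressor.exists_window {ι : Type*} [Fintype ι] {C T δ₀ ε t₁ : ℝ}
    {Φ : ℝ → ι → ℝ} (h : IsExcitingRegressor C T δ₀ ε t₁ Φ) (hT : 0 < T) (hδ₀ : 0 < δ₀)
    {σ : ℝ} (hσ : 4 * C * σ ≤ T * ε) {t : ℝ} (ht : t₁ ≤ t) {v : ι → ℝ}
    (hv : l2norm v ≠ 0) :
    ∃ t₂, t ≤ t₂ ∧ t₂ + δ₀ ≤ t + T ∧ ∀ a ∈ Icc t₂ (t₂ + σ), ∀ b ∈ Icc (t₂ + δ₀) (t₂ + δ₀ + σ),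
      T * ε / 2 * l2norm v ≤ |∫ τ in a..b, Φ τ ⬝ᵥ v| := by
  have hv1 : 0 < l2norm v := lt_of_le_of_ne (l2norm_nonneg v) (Ne.symm hv)
  obtain ⟨t₂, h1, h2, h3⟩ := h.exciting t ht ((l2norm v)⁻¹ • v) (by
    rw [l2norm_smul, abs_of_pos (inv_pos.2 hv1), inv_mul_cancel₀ hv])
  refine ⟨t₂, h1, h2, fun a ha b hb => ?_⟩
  set ω := (l2norm v)⁻¹ • v with hω
  have hω1 : l2norm ω = 1 := by
    rw [l2norm_smul, abs_of_pos (inv_pos.2 hv1), inv_mul_cancel₀ hv]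
  have hpert := abs_integral_sub_integral_le (f := fun τ => Φ τ ⬝ᵥ ω) (s := t₁) (C := C)
    (fun x hx => (abs_dotProduct_le _ _).trans (by rw [hω1, mul_one]; exact h.bound x hx))
    (by
      have := h.cont
      have hc : Continuous fun u : ι → ℝ => u ⬝ᵥ ω := by fun_prop
      exact hc.comp_continuousOn this)
    (by linarith [ha.1]) (by linarith [hb.1]) ha hb (by linarith) (by linarith)
  rw [one_div, inv_mul_eq_div, le_div_iff₀ hT] at h3
  -- Moving the endpoints costs at most 2Cσ ≤ Tε/2, which leaves half of the excitation level.
  have hab : T * ε / 2 ≤ |∫ τ in a..b, Φ τ ⬝ᵥ ω| := by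
    have := abs_sub_abs_le_abs_sub (∫ τ in t₂..(t₂ + δ₀), Φ τ ⬝ᵥ ω) (∫ τ in a..b, Φ τ ⬝ᵥ ω)
    rw [abs_sub_comm] at this
    linarith
  have hvω : ∀ τ, Φ τ ⬝ᵥ v = l2norm v * (Φ τ ⬝ᵥ ω) := by
    intro τ
    rw [hω, dotProduct_smul, smul_eq_mul, mul_inv_cancel_left₀ hv]
  simp only [hvω]
  rw [intervalIntegral.integral_const_mul, abs_mul, abs_of_pos hv1, mul_comm]
  exact mul_le_mul_of_nonneg_left hab hv1.le

namespace IsErrorSolution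

variable {n m : ℕ} {S : MSACData n m} {mode : GainAdaptation} {Φ : ℝ → RegIdx n m → ℝ}
  {t₁ : ℝ} {z : ℝ → ErrState n m} {p L w : ℝ}

theorem continuousOn_e (hz : IsErrorSolution S mode Φ t₁ z) :
    ContinuousOn (fun s => (z s).e) (Ici t₁) :=
  fun t ht => (hz.deriv_e t ht).continuousWithinAt

theorem continuousOn_Xi (hz : IsErrorSolution S mode Φ t₁ z) (i : Fin m) (j : RegIdx n m) :
    ContinuousOn (fun s => (z s).Xi i j) (Ici t₁) :=
  fun t ht => (hz.deriv_Xi t ht i j).continuousWithinAt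

theorem continuousOn_Th (hz : IsErrorSolution S mode Φ t₁ z) (i : Fin m) (j : RegIdx n m) :
    ContinuousOn (fun s => (z s).Th i j) (Ici t₁) :=
  fun t ht => (hz.deriv_Th t ht i j).continuousWithinAt

theorem continuousOn_dissipated (hz : IsErrorSolution S mode Φ t₁ z) :
    ContinuousOn (fun s => (z s).dissipated) (Ici t₁) := by
  unfold ErrState.dissipated
  simp only [frobNorm_sq, Matrix.sub_apply]
  exact ((continuous_l2norm.comp_continuousOn hz.continuousOn_e).pow 2).add
    (continuousOn_finsetSum _ fun i _ => continuousOn_finsetSum _ fun j _ =>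
      ((hz.continuousOn_Th i j).sub (hz.continuousOn_Xi i j)).pow 2)

theorem continuousOn_sqrt_dissipated (hz : IsErrorSolution S mode Φ t₁ z) :
    ContinuousOn (fun s => Real.sqrt (z s).dissipated) (Ici t₁) :=
  hz.continuousOn_dissipated.sqrt

theorem continuousOn_lyapunov (hz : IsErrorSolution S mode Φ t₁ z) (h : S.Bounds p L w) :
    ContinuousOn (fun s => S.lyapunov (z s)) (Ici t₁) :=
  fun _ ht => (hz.hasDerivWithinAt_lyapunov h ht).continuousWithinAt

theorem integral_sqrt_dissipated_le (hz : IsErrorSolution S mode Φ t₁ z) {a b c H : ℝ}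
    (hc : t₁ ≤ c) (hca : c ≤ a) (hab : a ≤ b) (hb : b ≤ c + H) :
    ∫ τ in a..b, Real.sqrt (z τ).dissipated
      ≤ Real.sqrt H * Real.sqrt (∫ τ in c..(c + H), (z τ).dissipated) := by
  have hsub : Icc c (c + H) ⊆ Ici t₁ := fun τ hτ => hc.trans hτ.1
  have hcH : c ≤ c + H := hca.trans (hab.trans hb)
  refine (integral_le_integral_of_subinterval hca hab hb
    (hz.continuousOn_sqrt_dissipated.mono hsub) fun _ => Real.sqrt_nonneg _).trans ?_
  rw [← Real.sqrt_mul (by linarith)]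
  refine Real.le_sqrt_of_sq_le ((sq_integral_le hcH
    (hz.continuousOn_sqrt_dissipated.mono hsub)).trans_eq ?_)
  simp only [Real.sq_sqrt (ErrState.dissipated_nonneg _), add_sub_cancel_left]

theorem abs_tunerRate_le (h : S.Bounds p L w) {C : ℝ} {φ : RegIdx n m → ℝ}
    (hφ : l2norm φ ≤ C) (mode : GainAdaptation) (z : ErrState n m) (i : Fin m)
    (j : RegIdx n m) :
    |S.tunerRate mode z.e φ i j|
      ≤ S.γ * (frobNorm (S.P * S.Bp) * C) * Real.sqrt z.dissipated := by
  have hC : 0 ≤ C := (l2norm_nonneg _).trans hφ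
  have hF := frobNorm_nonneg (S.P * S.Bp)
  have hb := ((abs_apply_le_l2norm _ i).trans (h.l2norm_output_le z.e)).trans
    (mul_le_mul_of_nonneg_left z.l2norm_e_le hF)
  rw [S.tunerRate_apply, abs_neg, abs_mul, abs_of_pos h.gain_pos, mul_assoc]
  refine mul_le_mul_of_nonneg_left ?_ h.gain_pos.le
  rw [abs_mul, abs_mul]
  calc _ ≤ 1 * ((frobNorm (S.P * S.Bp) * Real.sqrt z.dissipated) * C) :=
        mul_le_mul (mode.abs_mask_le i j)
          (mul_le_mul hb ((abs_apply_le_l2norm _ _).trans hφ) (abs_nonneg _)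
            (mul_nonneg hF (Real.sqrt_nonneg _))) (by positivity) zero_le_one
    _ = _ := by ring

/-- The tuner is driven only by e, so its drift over a window is controlled by the dissipation. This
is what allows Ξ to be frozen there. -/
theorem abs_Xi_sub_le (hz : IsErrorSolution S mode Φ t₁ z) (h : S.Bounds p L w) {C : ℝ}
    (hC : ∀ t, t₁ ≤ t → l2norm (Φ t) ≤ C) {t τ H : ℝ} (ht : t₁ ≤ t) (hτ : τ ∈ Icc t (t + H))
    (i : Fin m) (j : RegIdx n m) :
    |(z τ).Xi i j - (z t).Xi i j| ≤ S.γ * (frobNorm (S.P * S.Bp) * C) *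
      (Real.sqrt H * Real.sqrt (∫ s in t..(t + H), (z s).dissipated)) := by
  have hsub : Icc t τ ⊆ Ici t₁ := fun s hs => ht.trans hs.1
  have hC0 : 0 ≤ C := (l2norm_nonneg _).trans (hC t ht)
  have h1 := abs_sub_sub_integral_le (f := fun _ => 0) hτ.1
    ((hz.continuousOn_Xi i j).mono hsub)
    (fun x hx => ((hz.deriv_Xi x (ht.trans hx.1.le) i j).mono
      (fun y hy => (ht.trans hx.1.le).trans (le_of_lt hy))))
    continuousOn_const
    ((hz.continuousOn_sqrt_dissipated.mono hsub).const_smul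
      (S.γ * (frobNorm (S.P * S.Bp) * C)))
    (fun x hx => by
      rw [sub_zero]
      exact abs_tunerRate_le h (hC x (ht.trans hx.1.le)) mode (z x) i j)
  simp only [intervalIntegral.integral_zero, sub_zero, Pi.smul_apply, smul_eq_mul] at h1
  rw [intervalIntegral.integral_const_mul] at h1
  exact h1.trans (mul_le_mul_of_nonneg_left
    (hz.integral_sqrt_dissipated_le ht le_rfl hτ.1 hτ.2)
    (mul_nonneg h.gain_pos.le (mul_nonneg (frobNorm_nonneg _) hC0)))

open Matrix in
theorem abs_scaled_mulVec_sub_le (h : S.Bounds p L w) {C N : ℝ} {φ : RegIdx n m → ℝ}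
    (hφ : l2norm φ ≤ C) (M : ParamMatrix n m) (x : RegIdx n m → ℝ) (i : Fin m)
    (hd : ∀ k, |M i k - x k| ≤ N) :
    |(S.scaled M *ᵥ φ) i - φ ⬝ᵥ fun k => S.weight i k * x k|
      ≤ Fintype.card (RegIdx n m) * (L * C) * N := by
  have h2 : ((S.scaled M *ᵥ φ) i - φ ⬝ᵥ fun k => S.weight i k * x k)
      = ∑ k, S.weight i k * (M i k - x k) * φ k := by
    rw [dotProduct_comm]
    simp only [mulVec, dotProduct, S.scaled_apply, ← Finset.sum_sub_distrib]
    exact Finset.sum_congr rfl fun k _ => by ring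
  rw [h2]
  refine (Finset.abs_sum_le_sum_abs _ _).trans ?_
  have hle : ∀ k ∈ (Finset.univ : Finset (RegIdx n m)),
      |S.weight i k * (M i k - x k) * φ k| ≤ L * N * C := by
    intro k _
    have hN : 0 ≤ N := (abs_nonneg _).trans (hd k)
    rw [abs_mul, abs_mul, abs_of_pos (h.w_pos.trans_le (h.le_weight i k))]
    exact mul_le_mul (mul_le_mul (h.weight_le i k) (hd k) (abs_nonneg _) h.L_pos.le)
      ((abs_apply_le_l2norm _ k).trans hφ) (abs_nonneg _) (mul_nonneg h.L_pos.le hN)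
  refine (Finset.sum_le_card_nsmul _ _ _ hle).trans_eq ?_
  rw [nsmul_eq_mul, Finset.card_univ]
  ring

open Matrix in
theorem hasDerivWithinAt_leftInverse (hz : IsErrorSolution S mode Φ t₁ z)
    {Li : Matrix (Fin m) (Fin n) ℝ} (hLi : Li * S.Bp = 1) {t : ℝ} (ht : t₁ ≤ t) (i : Fin m) :
    HasDerivWithinAt (fun s => (Li *ᵥ (z s).e) i)
      (((Li * S.Am) *ᵥ (z t).e) i + (S.scaled (z t).Th *ᵥ Φ t) i) (Ici t₁) t := by
  have he := hasDerivWithinAt_pi.1 (hz.deriv_e t ht)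
  have h1 := HasDerivWithinAt.fun_sum (u := Finset.univ) fun k _ => (he k).const_mul (Li i k)
  refine h1.congr_deriv ?_
  change (Li *ᵥ (S.Am *ᵥ (z t).e + S.Bp *ᵥ (S.scaled (z t).Th *ᵥ Φ t))) i = _
  rw [mulVec_add, mulVec_mulVec, mulVec_mulVec _ Li S.Bp, hLi, one_mulVec, Pi.add_apply]

-- Only integrals of Φ along fixed directions are known to be large, so the e-equation is integrated
-- rather than read pointwise. Row i of Ξ at time t, weighted, is the fixed direction v.
open Matrix in
theorem exists_abs_Xi_le (S : MSACData n m) (h : S.Bounds p L w) (hB : S.Bp.rank = m)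
    {C T δ₀ ε σ : ℝ} (hC : 0 ≤ C) (hT : 0 < T) (hδ₀ : 0 < δ₀) (hε : 0 < ε) (hσ : 0 < σ)
    (hσδ : σ ≤ δ₀) (hσε : 4 * C * σ ≤ T * ε) :
    ∃ K, 0 ≤ K ∧ ∀ mode Φ t₁ z, IsExcitingRegressor C T δ₀ ε t₁ Φ →
      IsErrorSolution S mode Φ t₁ z → ∀ t, t₁ ≤ t → ∀ i j,
        |(z t).Xi i j| ≤ K * Real.sqrt (∫ s in t..(t + (T + σ)), (z s).dissipated) := by
  obtain ⟨Li, hLi⟩ := Matrix.exists_leftInverse_of_rank_eq hB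
  have hγ := h.gain_pos
  have hw := h.w_pos
  have hL := h.L_pos
  set H := T + σ with hH
  have hH0 : 0 < H := by positivity
  set kX := S.γ * (frobNorm (S.P * S.Bp) * C) * Real.sqrt H with hkX
  have hF := frobNorm_nonneg (S.P * S.Bp)
  have hkX0 : 0 ≤ kX := by positivity
  set kA := frobNorm (Li * S.Am) with hkA
  have hkA0 : 0 ≤ kA := frobNorm_nonneg _
  set kR := (Fintype.card (RegIdx n m) : ℝ) * (L * C) with hkR
  have hkR0 : 0 ≤ kR := by positivity
  have hLi0 := frobNorm_nonneg Li
  refine ⟨(2 * frobNorm Li / Real.sqrt σ + (kA + kR) * Real.sqrt H + H * (kR * kX))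
    / (T * ε / 2 * w), by positivity, ?_⟩
  intro mode Φ t₁ z hΦ hz t ht i j
  set J := ∫ s in t..(t + H), (z s).dissipated with hJ
  set q := Real.sqrt J with hq
  have hq0 : 0 ≤ q := Real.sqrt_nonneg _
  set v : RegIdx n m → ℝ := fun j => S.weight i j * (z t).Xi i j with hv
  have hvj : w * |(z t).Xi i j| ≤ l2norm v := by
    refine le_trans ?_ (abs_apply_le_l2norm v j)
    rw [hv, abs_mul, abs_of_pos (hw.trans_le (h.le_weight i j))]
    exact mul_le_mul_of_nonneg_right (h.le_weight i j) (abs_nonneg _)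
  rw [div_mul_eq_mul_div, le_div_iff₀ (by positivity)]
  suffices hmain : T * ε / 2 * l2norm v ≤
      (2 * frobNorm Li / Real.sqrt σ + (kA + kR) * Real.sqrt H + H * (kR * kX)) * q by
    refine le_trans ?_ hmain
    have : |(z t).Xi i j| * (T * ε / 2 * w) = T * ε / 2 * (w * |(z t).Xi i j|) := by ring
    rw [this]
    exact mul_le_mul_of_nonneg_left hvj (by positivity)
  -- Excitation is stated for unit vectors, so v = 0 cannot be normalized and is separated.
  by_cases hv0 : l2norm v = 0
  · rw [hv0, mul_zero]
    positivity
  obtain ⟨t₂, ht₂, ht₂T, hwin⟩ := hΦ.exists_window hT hδ₀ hσε ht hv0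
  have hcontD := hz.continuousOn_dissipated
  have hdn : ∀ s, 0 ≤ (z s).dissipated := fun s => ErrState.dissipated_nonneg _
  -- Pointwise values of e are not controlled by J, but on any interval of length σ some time has D
  -- ≤ J/σ.
  have hpick : ∀ c, t ≤ c → c + σ ≤ t + H →
      ∃ a ∈ Icc c (c + σ), Real.sqrt (z a).dissipated ≤ q / Real.sqrt σ := by
    intro c hc hcσ
    obtain ⟨a, ha, hle⟩ := exists_mul_le_integral (a := c) (b := c + σ)
      (f := fun s => (z s).dissipated) (by linarith)
      (hcontD.mono fun s hs => ht.trans (hc.trans hs.1))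
    refine ⟨a, ha, ?_⟩
    rw [hq, ← Real.sqrt_div' _ hσ.le]
    refine Real.sqrt_le_sqrt ?_
    rw [le_div_iff₀ hσ, mul_comm]
    rw [add_sub_cancel_left] at hle
    exact hle.trans (integral_le_integral_of_subinterval hc (by linarith) hcσ
      (hcontD.mono fun s hs => ht.trans hs.1) hdn)
  obtain ⟨a, ha, haq⟩ := hpick t₂ ht₂ (by linarith)
  obtain ⟨b, hb, hbq⟩ := hpick (t₂ + δ₀) (by linarith) (by linarith)
  refine (hwin a ha b hb).trans ?_
  have hta : t ≤ a := ht₂.trans ha.1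
  -- The two selection intervals do not cross because σ ≤ δ₀.
  have hab : a ≤ b := ha.2.trans (le_trans (by linarith) hb.1)
  have hbH : b ≤ t + H := hb.2.trans (by linarith)
  have hsub : Icc a b ⊆ Ici t₁ := fun s hs => ht.trans (hta.trans hs.1)
  have hLe : ∀ s, |(Li *ᵥ (z s).e) i| ≤ frobNorm Li * Real.sqrt (z s).dissipated := fun s =>
    (abs_apply_le_l2norm _ i).trans ((l2norm_mulVec_le _ _).trans
      (mul_le_mul_of_nonneg_left (z s).l2norm_e_le hLi0))
  have hderiv : ∀ x ∈ Ioo a b, HasDerivWithinAt (fun s => (Li *ᵥ (z s).e) i)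
      (((Li * S.Am) *ᵥ (z x).e) i + (S.scaled (z x).Th *ᵥ Φ x) i) (Ioi x) x := by
    intro x hx
    have hx1 : t₁ ≤ x := ht.trans (hta.trans hx.1.le)
    exact (hz.hasDerivWithinAt_leftInverse hLi hx1 i).mono fun y hy => hx1.trans (le_of_lt hy)
  have hcontΦ : ContinuousOn (fun s => Φ s ⬝ᵥ v) (Icc a b) := by
    have hc : Continuous fun u : RegIdx n m → ℝ => u ⬝ᵥ v := by fun_prop
    exact hc.comp_continuousOn (hΦ.cont.mono hsub)
  have hrest : ∀ x ∈ Ioo a b,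
      |((Li * S.Am) *ᵥ (z x).e) i + (S.scaled (z x).Th *ᵥ Φ x) i - Φ x ⬝ᵥ v|
        ≤ (kA + kR) * Real.sqrt (z x).dissipated + kR * (kX * q) := by
    intro x hx
    have hxt : t ≤ x := hta.trans hx.1.le
    set N := Real.sqrt (z x).dissipated
    have h1 : |((Li * S.Am) *ᵥ (z x).e) i| ≤ kA * N :=
      (abs_apply_le_l2norm _ i).trans ((l2norm_mulVec_le _ _).trans
        (mul_le_mul_of_nonneg_left (z x).l2norm_e_le hkA0))
    have h3 : |(S.scaled (z x).Th *ᵥ Φ x) i - Φ x ⬝ᵥ v| ≤ kR * (N + kX * q) := by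
      refine abs_scaled_mulVec_sub_le h (hΦ.bound x (ht.trans hxt)) _ _ i fun k => ?_
      have hX := hz.abs_Xi_sub_le h hΦ.bound ht (τ := x) (H := H)
        ⟨hxt, hx.2.le.trans hbH⟩ i k
      rw [← mul_assoc, ← hkX, ← hJ, ← hq] at hX
      have := abs_add_le ((z x).Th i k - (z x).Xi i k) ((z x).Xi i k - (z t).Xi i k)
      rw [sub_add_sub_cancel] at this
      exact this.trans (add_le_add ((z x).abs_Th_sub_Xi_le i k) hX)
    rw [add_sub_assoc]
    refine (abs_add_le _ _).trans ((add_le_add h1 h3).trans_eq ?_)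
    ring
  have hNc : ContinuousOn (fun s => Real.sqrt (z s).dissipated) (Icc a b) :=
    hz.continuousOn_sqrt_dissipated.mono hsub
  have hkey := abs_sub_sub_integral_le hab (g := fun s => (Li *ᵥ (z s).e) i)
    (by
      have hc : Continuous fun u : Fin n → ℝ => (Li *ᵥ u) i := by fun_prop
      exact hc.comp_continuousOn (hz.continuousOn_e.mono hsub))
    hderiv hcontΦ
    ((hNc.const_smul (kA + kR)).add continuousOn_const) hrest
  have hint : ∫ s in a..b, ((kA + kR) * Real.sqrt (z s).dissipated + kR * (kX * q))
      ≤ (kA + kR) * (Real.sqrt H * q) + H * (kR * (kX * q)) := by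
    rw [intervalIntegral.integral_add
      ((hNc.intervalIntegrable_of_Icc hab).const_mul _) intervalIntegrable_const,
      intervalIntegral.integral_const_mul, intervalIntegral.integral_const, smul_eq_mul]
    exact add_le_add (mul_le_mul_of_nonneg_left
      (hz.integral_sqrt_dissipated_le ht hta hab hbH) (by positivity))
      (mul_le_mul_of_nonneg_right (by linarith) (by positivity))
  have hga := (hLe a).trans (mul_le_mul_of_nonneg_left haq hLi0)
  have hgb := (hLe b).trans (mul_le_mul_of_nonneg_left hbq hLi0)
  have hkey2 := hkey.trans hint
  have htri : |∫ s in a..b, Φ s ⬝ᵥ v| ≤ |(Li *ᵥ (z b).e) i| + |(Li *ᵥ (z a).e) i|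
      + |(Li *ᵥ (z b).e) i - (Li *ᵥ (z a).e) i - ∫ s in a..b, Φ s ⬝ᵥ v| := by
    have h1 := abs_sub (((Li *ᵥ (z b).e) i - (Li *ᵥ (z a).e) i))
      ((Li *ᵥ (z b).e) i - (Li *ᵥ (z a).e) i - ∫ s in a..b, Φ s ⬝ᵥ v)
    have h2 := abs_sub ((Li *ᵥ (z b).e) i) ((Li *ᵥ (z a).e) i)
    rw [sub_sub_cancel] at h1
    linarith
  refine htri.trans ((add_le_add (add_le_add hgb hga) hkey2).trans_eq ?_)
  ring

end IsErrorSolution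

/-! ### Norm equivalence, contraction and uniform decay -/

section ErrState

variable {n m : ℕ} (z : ErrState n m)

theorem ErrState.size_nonneg : 0 ≤ z.size := Real.sqrt_nonneg _

theorem ErrState.size_sq :
    z.size ^ 2 = l2norm z.e ^ 2 + frobNorm z.Xi ^ 2 + frobNorm z.Th ^ 2 :=
  Real.sq_sqrt (by positivity)

theorem ErrState.frobNorm_Th_le_size : frobNorm z.Th ≤ z.size :=
  Real.le_sqrt_of_sq_le (le_add_of_nonneg_left (by positivity))

theorem ErrState.size_sq_le :
    z.size ^ 2 ≤ 3 * (z.dissipated + frobNorm z.Xi ^ 2) := by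
  have h : frobNorm z.Th ^ 2 ≤ 2 * frobNorm (z.Th - z.Xi) ^ 2 + 2 * frobNorm z.Xi ^ 2 := by
    simp only [frobNorm_sq, Finset.mul_sum, ← Finset.sum_add_distrib, Matrix.sub_apply]
    refine Finset.sum_le_sum fun i _ => Finset.sum_le_sum fun j _ => ?_
    nlinarith [sq_nonneg (z.Th i j - 2 * z.Xi i j)]
  rw [ErrState.size_sq, ErrState.dissipated]
  nlinarith [sq_nonneg (l2norm z.e), sq_nonneg (frobNorm (z.Th - z.Xi)),
    sq_nonneg (frobNorm z.Xi)]

theorem ErrState.dissipated_add_le :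
    z.dissipated + frobNorm z.Xi ^ 2 ≤ 3 * z.size ^ 2 := by
  have h : frobNorm (z.Th - z.Xi) ^ 2 ≤ 2 * frobNorm z.Th ^ 2 + 2 * frobNorm z.Xi ^ 2 := by
    simp only [frobNorm_sq, Finset.mul_sum, ← Finset.sum_add_distrib, Matrix.sub_apply]
    refine Finset.sum_le_sum fun i _ => Finset.sum_le_sum fun j _ => ?_
    nlinarith [sq_nonneg (z.Th i j + z.Xi i j)]
  rw [ErrState.size_sq, ErrState.dissipated]
  nlinarith [sq_nonneg (l2norm z.e), sq_nonneg (frobNorm z.Th), sq_nonneg (frobNorm z.Xi)]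

end ErrState

namespace MSACData.Bounds

variable {n m : ℕ} {S : MSACData n m} {p L w : ℝ}

theorem exists_lyapunov_le (h : S.Bounds p L w) :
    ∃ k > 0, ∀ z : ErrState n m, S.lyapunov z ≤ k * (z.dissipated + frobNorm z.Xi ^ 2) := by
  have hγ := h.gain_pos
  have hL := h.L_pos
  have hP := frobNorm_nonneg S.P
  refine ⟨frobNorm S.P + L / S.γ, by positivity, fun z => ?_⟩
  have h1 : z.e ⬝ᵥ S.P.mulVec z.e ≤ frobNorm S.P * l2norm z.e ^ 2 := by
    refine (le_abs_self _).trans ((abs_dotProduct_le _ _).trans ?_)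
    calc _ ≤ l2norm z.e * (frobNorm S.P * l2norm z.e) :=
          mul_le_mul_of_nonneg_left (l2norm_mulVec_le _ _) (l2norm_nonneg _)
      _ = _ := by ring
  have h2 : ∑ i, ∑ j, S.weight i j * (z.Xi i j ^ 2 + (z.Th i j - z.Xi i j) ^ 2)
      ≤ L * (frobNorm z.Xi ^ 2 + frobNorm (z.Th - z.Xi) ^ 2) := by
    simp only [frobNorm_sq, Finset.mul_sum, ← Finset.sum_add_distrib, Matrix.sub_apply]
    exact Finset.sum_le_sum fun i _ => Finset.sum_le_sum fun j _ =>
      mul_le_mul_of_nonneg_right (h.weight_le i j) (by positivity)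
  calc S.lyapunov z ≤ frobNorm S.P * l2norm z.e ^ 2
        + 1 / S.γ * (L * (frobNorm z.Xi ^ 2 + frobNorm (z.Th - z.Xi) ^ 2)) :=
        add_le_add h1 (mul_le_mul_of_nonneg_left h2 (by positivity))
    _ = frobNorm S.P * l2norm z.e ^ 2
        + L / S.γ * (frobNorm z.Xi ^ 2 + frobNorm (z.Th - z.Xi) ^ 2) := by ring
    _ ≤ frobNorm S.P * l2norm z.e ^ 2
        + L / S.γ * (frobNorm z.Xi ^ 2 + frobNorm (z.Th - z.Xi) ^ 2)
        + (frobNorm S.P * (frobNorm z.Xi ^ 2 + frobNorm (z.Th - z.Xi) ^ 2)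
          + L / S.γ * l2norm z.e ^ 2) := le_add_of_nonneg_right (by positivity)
    _ = _ := by rw [ErrState.dissipated]; ring

theorem exists_le_lyapunov (h : S.Bounds p L w) :
    ∃ k > 0, ∀ z : ErrState n m, k * (z.dissipated + frobNorm z.Xi ^ 2) ≤ S.lyapunov z := by
  have hγ := h.gain_pos
  have hw := h.w_pos
  have hp := h.p_pos
  refine ⟨min p (w / S.γ), by positivity, fun z => ?_⟩
  have h2 : w * (frobNorm z.Xi ^ 2 + frobNorm (z.Th - z.Xi) ^ 2)
      ≤ ∑ i, ∑ j, S.weight i j * (z.Xi i j ^ 2 + (z.Th i j - z.Xi i j) ^ 2) := by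
    simp only [frobNorm_sq, Finset.mul_sum, ← Finset.sum_add_distrib, Matrix.sub_apply]
    exact Finset.sum_le_sum fun i _ => Finset.sum_le_sum fun j _ =>
      mul_le_mul_of_nonneg_right (h.le_weight i j) (by positivity)
  calc _ = min p (w / S.γ) * l2norm z.e ^ 2
        + min p (w / S.γ) * (frobNorm z.Xi ^ 2 + frobNorm (z.Th - z.Xi) ^ 2) := by
        rw [ErrState.dissipated]; ring
    _ ≤ p * l2norm z.e ^ 2
        + w / S.γ * (frobNorm z.Xi ^ 2 + frobNorm (z.Th - z.Xi) ^ 2) := by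
        gcongr
        · exact min_le_left _ _
        · exact min_le_right _ _
    _ = p * l2norm z.e ^ 2
        + 1 / S.γ * (w * (frobNorm z.Xi ^ 2 + frobNorm (z.Th - z.Xi) ^ 2)) := by ring
    _ ≤ _ := add_le_add (h.P_ge z.e) (mul_le_mul_of_nonneg_left h2 (by positivity))

end MSACData.Bounds

namespace IsErrorSolution

variable {n m : ℕ} {S : MSACData n m} {p L w : ℝ}

theorem exists_lyapunov_decrease (h : S.Bounds p L w) (C : ℝ) :
    ∃ c > 0, ∀ mode Φ t₁ z, (∀ t, t₁ ≤ t → l2norm (Φ t) ≤ C) →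
      IsErrorSolution S mode Φ t₁ z → ∀ a b, t₁ ≤ a → a ≤ b →
        S.lyapunov (z b) + c * ∫ s in a..b, (z s).dissipated ≤ S.lyapunov (z a) := by
  obtain ⟨c, hc, hrate⟩ := h.lyapunovRate_le C
  refine ⟨c, hc, fun mode Φ t₁ z hΦ hz a b ha hab => ?_⟩
  have hsub : Icc a b ⊆ Ici t₁ := fun s hs => ha.trans hs.1
  have h1 := intervalIntegral.sub_le_integral_of_hasDeriv_right_of_le hab
    ((hz.continuousOn_lyapunov h).mono hsub)
    (fun x hx => (hz.hasDerivWithinAt_lyapunov h (ha.trans hx.1.le)).mono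
      fun y hy => (ha.trans hx.1.le).trans (le_of_lt hy))
    (φ := fun s => -c * (z s).dissipated)
    ((hz.continuousOn_dissipated.mono hsub).const_smul (-c)).integrableOn_Icc
    (fun x hx => by
      rw [neg_mul]
      exact hrate (z x) (Φ x) (hΦ x (ha.trans hx.1.le)))
  rw [intervalIntegral.integral_const_mul] at h1
  linarith

theorem lyapunov_anti (h : S.Bounds p L w) {C : ℝ} {mode : GainAdaptation}
    {Φ : ℝ → RegIdx n m → ℝ} {t₁ : ℝ} {z : ℝ → ErrState n m}
    (hΦ : ∀ t, t₁ ≤ t → l2norm (Φ t) ≤ C) (hz : IsErrorSolution S mode Φ t₁ z) {a b : ℝ}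
    (ha : t₁ ≤ a) (hab : a ≤ b) : S.lyapunov (z b) ≤ S.lyapunov (z a) := by
  obtain ⟨c, hc, hdec⟩ := exists_lyapunov_decrease h C
  have h1 := hdec mode Φ t₁ z hΦ hz a b ha hab
  have h2 : 0 ≤ ∫ s in a..b, (z s).dissipated :=
    intervalIntegral.integral_nonneg hab fun s _ => (z s).dissipated_nonneg
  nlinarith [mul_nonneg hc.le h2]

/-- At a time τ where D is at most its mean J/H, Ξ is also O(√J), so monotonicity gives V(t + H) ≤
V(τ) ≤ K'J. Combined with V(t + H) + cJ ≤ V(t), this yields the ratio K'/(c + K'). -/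
theorem exists_lyapunov_contraction (h : S.Bounds p L w) (hB : S.Bp.rank = m)
    {C T δ₀ ε : ℝ} (hC : 0 ≤ C) (hT : 0 < T) (hδ₀ : 0 < δ₀) (hε : 0 < ε) :
    ∃ H > 0, ∃ ρ, 0 ≤ ρ ∧ ρ < 1 ∧ ∀ mode Φ t₁ z, IsExcitingRegressor C T δ₀ ε t₁ Φ →
      IsErrorSolution S mode Φ t₁ z → ∀ t, t₁ ≤ t →
        S.lyapunov (z (t + H)) ≤ ρ * S.lyapunov (z t) := by
  obtain ⟨σ, hσ, hσδ, hσε⟩ : ∃ σ > 0, σ ≤ δ₀ ∧ 4 * C * σ ≤ T * ε := by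
    -- C + 1 keeps the denominator positive when C = 0.
    refine ⟨min δ₀ (T * ε / (4 * (C + 1))), by positivity, min_le_left _ _, ?_⟩
    calc 4 * C * min δ₀ (T * ε / (4 * (C + 1))) ≤ 4 * (C + 1) * (T * ε / (4 * (C + 1))) := by
          gcongr
          · linarith
          · exact min_le_right _ _
      _ = T * ε := by field_simp
  obtain ⟨K, hK, hXi⟩ := exists_abs_Xi_le S h hB hC hT hδ₀ hε hσ hσδ hσε
  obtain ⟨c, hc, hdec⟩ := exists_lyapunov_decrease h C
  obtain ⟨k, hk, hVle⟩ := h.exists_lyapunov_le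
  set H := T + σ with hH
  have hH0 : 0 < H := by positivity
  have hγ := h.gain_pos
  have hF := frobNorm_nonneg (S.P * S.Bp)
  set kX := S.γ * (frobNorm (S.P * S.Bp) * C) * Real.sqrt H with hkX
  have hkX0 : 0 ≤ kX := by positivity
  set K' := k * (1 / H + m * (Fintype.card (RegIdx n m) * (K + kX) ^ 2)) with hK'
  have hK'0 : 0 < K' := by positivity
  refine ⟨H, hH0, K' / (c + K'), by positivity, (div_lt_one (by positivity)).2 (by linarith),
    fun mode Φ t₁ z hΦ hz t ht => ?_⟩
  have hcontD := hz.continuousOn_dissipated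
  obtain ⟨τ, hτ, hτJ⟩ := exists_mul_le_integral (a := t) (b := t + H)
    (f := fun s => (z s).dissipated) (by linarith) (hcontD.mono fun s hs => ht.trans hs.1)
  have hJdec := hdec mode Φ t₁ z hΦ.bound hz t (t + H) ht (by linarith)
  have hJ0 : 0 ≤ ∫ s in t..(t + H), (z s).dissipated :=
    intervalIntegral.integral_nonneg (by linarith) fun s _ => (z s).dissipated_nonneg
  have hXi0 := hXi mode Φ t₁ z hΦ hz t ht
  have hXiτ : ∀ i j, |(z τ).Xi i j|
      ≤ (K + kX) * Real.sqrt (∫ s in t..(t + H), (z s).dissipated) := by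
    intro i j
    have h1 := hz.abs_Xi_sub_le h hΦ.bound ht hτ i j
    rw [← mul_assoc, ← hkX] at h1
    have h2 := abs_add_le ((z τ).Xi i j - (z t).Xi i j) ((z t).Xi i j)
    rw [sub_add_cancel] at h2
    linarith [hXi0 i j]
  have hanti := lyapunov_anti h hΦ.bound hz (ht.trans hτ.1) hτ.2
  set J := ∫ s in t..(t + H), (z s).dissipated with hJ
  rw [add_sub_cancel_left] at hτJ
  have hD : (z τ).dissipated ≤ 1 / H * J := by
    rw [one_div, inv_mul_eq_div, le_div_iff₀ hH0]
    linarith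
  have hX2 : frobNorm (z τ).Xi ^ 2 ≤ m * (Fintype.card (RegIdx n m) * (K + kX) ^ 2) * J := by
    rw [frobNorm_sq]
    have hij : ∀ i j, (z τ).Xi i j ^ 2 ≤ (K + kX) ^ 2 * J := by
      intro i j
      have := pow_le_pow_left₀ (abs_nonneg _) (hXiτ i j) 2
      rwa [sq_abs, mul_pow, Real.sq_sqrt hJ0] at this
    refine (Finset.sum_le_sum fun i _ => Finset.sum_le_sum fun j _ => hij i j).trans_eq ?_
    rw [Finset.sum_const, Finset.sum_const, Finset.card_univ, Finset.card_univ, Fintype.card_fin]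
    simp only [nsmul_eq_mul]
    ring
  have hV : S.lyapunov (z (t + H)) ≤ K' * J := by
    refine hanti.trans ((hVle _).trans ?_)
    calc _ ≤ k * (1 / H * J + m * (Fintype.card (RegIdx n m) * (K + kX) ^ 2) * J) :=
          mul_le_mul_of_nonneg_left (add_le_add hD hX2) hk.le
      _ = _ := by rw [hK']; ring
  rw [div_mul_eq_mul_div, le_div_iff₀ (by positivity)]
  nlinarith [mul_le_mul_of_nonneg_left hJdec hK'0.le, mul_le_mul_of_nonneg_left hV hc.le]

/-- Solutions driven by exciting regressors are bounded by a fixed multiple of their initial size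
and contract by any prescribed factor within a uniform time. -/
theorem exists_size_le (h : S.Bounds p L w) (hB : S.Bp.rank = m)
    {C T δ₀ ε : ℝ} (hC : 0 ≤ C) (hT : 0 < T) (hδ₀ : 0 < δ₀) (hε : 0 < ε) :
    (∃ R > 0, ∀ mode Φ t₁ z, IsExcitingRegressor C T δ₀ ε t₁ Φ →
      IsErrorSolution S mode Φ t₁ z → ∀ t, t₁ ≤ t → (z t).size ≤ R * (z t₁).size) ∧
    (∀ η > 0, ∃ τ > 0, ∀ mode Φ t₁ z, IsExcitingRegressor C T δ₀ ε t₁ Φ →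
      IsErrorSolution S mode Φ t₁ z → ∀ t, t₁ + τ ≤ t → (z t).size ≤ η * (z t₁).size) := by
  obtain ⟨k₁, hk₁, hlow⟩ := h.exists_le_lyapunov
  obtain ⟨k₂, hk₂, hup⟩ := h.exists_lyapunov_le
  obtain ⟨H, hH, ρ, hρ0, hρ1, hcon⟩ := exists_lyapunov_contraction h hB hC hT hδ₀ hε
  have hlow' : ∀ z : ErrState n m, z.size ^ 2 ≤ 3 / k₁ * S.lyapunov z := by
    intro z
    refine z.size_sq_le.trans ?_
    rw [div_mul_eq_mul_div, le_div_iff₀ hk₁]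
    nlinarith [hlow z]
  have hup' : ∀ z : ErrState n m, S.lyapunov z ≤ 3 * k₂ * z.size ^ 2 := by
    intro z
    nlinarith [hup z, mul_le_mul_of_nonneg_left z.dissipated_add_le hk₂.le]
  set M := 9 * k₂ / k₁ with hM
  have hM0 : 0 < M := by positivity
  have hsize : ∀ (x y : ErrState n m) (r : ℝ), 0 ≤ r → S.lyapunov x ≤ r * S.lyapunov y →
      x.size ^ 2 ≤ r * M * y.size ^ 2 := by
    intro x y r hr hxy
    calc x.size ^ 2 ≤ 3 / k₁ * (r * (3 * k₂ * y.size ^ 2)) :=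
          (hlow' x).trans (mul_le_mul_of_nonneg_left
            (hxy.trans (mul_le_mul_of_nonneg_left (hup' y) hr)) (by positivity))
      _ = _ := by rw [hM]; ring
  constructor
  · refine ⟨Real.sqrt M, Real.sqrt_pos.2 hM0, fun mode Φ t₁ z hΦ hz t ht => ?_⟩
    refine le_of_sq_le_sq ?_ (mul_nonneg (Real.sqrt_nonneg _) (ErrState.size_nonneg _))
    rw [mul_pow, Real.sq_sqrt hM0.le]
    have := hsize (z t) (z t₁) 1 zero_le_one
      (by rw [one_mul]; exact lyapunov_anti h hΦ.bound hz le_rfl ht)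
    rwa [one_mul] at this
  · intro η hη
    -- Squared sizes contract by ρ ^ N up to the norm-equivalence factor M. The time (N + 1)H,
    -- rather than NH, stays positive when N = 0.
    obtain ⟨N, hN⟩ := exists_pow_lt_of_lt_one (show 0 < η ^ 2 / M by positivity) hρ1
    refine ⟨(N + 1) * H, by positivity, fun mode Φ t₁ z hΦ hz t ht => ?_⟩
    have hiter : ∀ j : ℕ, S.lyapunov (z (t₁ + j * H)) ≤ ρ ^ j * S.lyapunov (z t₁) := by
      intro j
      induction j with
      | zero => simp
      | succ j ih =>
        have h1 := hcon mode Φ t₁ z hΦ hz (t₁ + j * H)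
          (le_add_of_nonneg_right (by positivity))
        have e : t₁ + ((j + 1 : ℕ) : ℝ) * H = t₁ + j * H + H := by push_cast; ring
        rw [e, pow_succ', mul_assoc]
        exact h1.trans (mul_le_mul_of_nonneg_left ih hρ0)
    have hNt : t₁ + N * H ≤ t := by linarith
    have hV := (lyapunov_anti h hΦ.bound hz (le_add_of_nonneg_right (by positivity)) hNt).trans
      (hiter N)
    refine le_of_sq_le_sq ((hsize _ _ _ (pow_nonneg hρ0 N) hV).trans ?_)
      (mul_nonneg hη.le (ErrState.size_nonneg _))
    rw [mul_pow]
    exact mul_le_mul_of_nonneg_right ((lt_div_iff₀ hM0).1 hN).le (sq_nonneg _)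

end IsErrorSolution

/-! ### The closed loop and the conclusion -/

theorem continuous_ballSat {ι : Type*} [Fintype ι] {umax : ℝ} (h : 0 < umax) :
    Continuous (ballSat umax : (ι → ℝ) → ι → ℝ) := by
  -- A single formula covers both branches, with a denominator that never vanishes.
  have heq : (ballSat umax : (ι → ℝ) → ι → ℝ)
      = fun u => (umax / max umax (l2norm u)) • u := by
    funext u
    unfold ballSat
    split_ifs with hu
    · rw [max_eq_left hu, div_self h.ne', one_smul]
    · rw [max_eq_right (not_le.1 hu).le]
  rw [heq]
  have hn := continuous_l2norm (ι := ι)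
  exact (continuous_const.div (continuous_const.max hn)
    fun u => (h.trans_le (le_max_left _ _)).ne').smul continuous_id

/-- Since Λ is diagonal, subtracting the true parameter keeps the errors supported on adapted
entries. -/
theorem MSACData.proj_Theta {n m : ℕ} (S : MSACData n m) (mode : GainAdaptation) :
    mode.proj S.Theta = S.Theta := by
  cases mode
  · rfl
  · funext i j
    rcases j with j | j | j <;> simp +contextual [GainAdaptation.proj, Theta, Lam, Matrix.diagonal_apply]

theorem GainAdaptation.proj_sub {n m : ℕ} (mode : GainAdaptation) (M N : ParamMatrix n m) :
    mode.proj (M - N) = mode.proj M - mode.proj N := by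
  funext i j
  simp [mode.proj_apply, mul_sub]

namespace IsClosedLoop

variable {n m : ℕ} {S : MSACData n m} {mode : GainAdaptation} {t₁ : ℝ} {s : Signals n m}

theorem continuousOn_regressor (hs : IsClosedLoop S mode t₁ s) (humax : 0 < S.umax) :
    ContinuousOn (s.regressor S.umax) (Ici t₁) := by
  have hx : ContinuousOn s.xp (Ici t₁) := fun t ht => (hs.deriv_xp t ht).continuousWithinAt
  have hT : ∀ i j, ContinuousOn (fun τ => s.ThHat τ i j) (Ici t₁) :=
    fun i j t ht => (hs.deriv_ThHat t ht i j).continuousWithinAt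
  have hu : ContinuousOn s.u (Ici t₁) := continuousOn_pi.2 fun i =>
    (continuousOn_finsetSum _ fun j _ => (hT i _).mul (continuousOn_pi.1 hx j)).add
      (continuousOn_finsetSum _ fun j _ => (hT i _).mul (continuousOn_pi.1 hs.cont_r j))
  have hd : ContinuousOn (s.du S.umax) (Ici t₁) :=
    ((continuous_ballSat humax).comp_continuousOn hu).sub hu
  refine continuousOn_pi.2 ?_
  rintro (j | j | j)
  · exact continuousOn_pi.1 hx j
  · exact continuousOn_pi.1 hs.cont_r j
  · exact (continuousOn_pi.1 hd j).neg

open Matrix in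
/-- The errors along a closed-loop trajectory solve the error system driven by its regressor. -/
theorem isErrorSolution (hs : IsClosedLoop S mode t₁ s)
    (hKx : S.Ap + S.Bp * S.Lam * S.Kx = S.Am) (hKr : S.Bp * S.Lam * S.Kr = S.Bm) :
    IsErrorSolution S mode (s.regressor S.umax) t₁ (s.err S) where
  Xi_mem t ht := by
    simp only [Signals.err]
    rw [mode.proj_sub, S.proj_Theta, hs.Xi_mem t ht]
  Th_mem t ht := by
    simp only [Signals.err]
    rw [mode.proj_sub, S.proj_Theta, hs.ThHat_mem t ht]
  deriv_e t ht := by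
    refine (((hs.deriv_xp t ht).sub (hs.deriv_xm t ht)).sub (hs.deriv_eD t ht)).congr_deriv ?_
    -- The entry -Δu of the regressor turns the last block into -(Λ̂ - Λ)Δu: the Λ̂ part is what e_Δ
    -- removes, and the Λ part is the true effect of saturation on the plant.
    have hscaled : S.scaled (s.err S t).Th *ᵥ s.regressor S.umax t
        = S.Lam *ᵥ (s.u t) - S.Lam *ᵥ (S.Kx *ᵥ s.xp t) - S.Lam *ᵥ (S.Kr *ᵥ s.r t)
          - (s.LamHat t *ᵥ s.du S.umax t - S.Lam *ᵥ s.du S.umax t) := by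
      funext i
      have hLam : ∀ v : Fin m → ℝ, (S.Lam *ᵥ v) i = S.lam i * v i :=
        fun v => mulVec_diagonal _ _ _
      have hlast : ∑ j, S.Lam i j * s.du S.umax t j = S.lam i * s.du S.umax t i := hLam _
      simp only [Pi.sub_apply, hLam]
      simp only [Signals.err, Signals.regressor, Signals.u, Signals.LamHat, mulVec, dotProduct,
        Fintype.sum_sum_type, Sum.elim_inl, Sum.elim_inr, MSACData.scaled, MSACData.Theta,
        Pi.neg_apply, Matrix.sub_apply, sub_mul, mul_sub, Finset.sum_sub_distrib,
        mul_neg, Finset.sum_neg_distrib, hlast, mul_add, Finset.mul_sum, mul_assoc]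
      ring
    have hsat : ballSat S.umax (s.u t) = s.du S.umax t + s.u t := by
      rw [Signals.du, sub_add_cancel]
    have hAp : S.Ap = S.Am - S.Bp * S.Lam * S.Kx := eq_sub_of_add_eq hKx
    rw [hscaled, hsat, hAp, ← hKr]
    simp only [Signals.err, Signals.eu, mulVec_add, mulVec_sub, sub_mulVec, ← mulVec_mulVec]
    abel
  deriv_Xi t ht i j := by
    refine ((hs.deriv_Xi t ht i j).sub_const (S.Theta i j)).congr_deriv ?_
    rfl
  deriv_Th t ht i j := by
    refine ((hs.deriv_ThHat t ht i j).sub_const (S.Theta i j)).congr_deriv ?_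
    simp [Signals.err]

end IsClosedLoop

/-- Bounds linear in the initial size are stronger than the ε–δ notions: attractivity may use the
ball of radius 1, and accuracy uses the contraction factor δ/ε₁. -/
theorem uniformlyAsymptoticallyStable_and_reachesAccuracy {n m : ℕ} {t₀ : ℝ}
    {Traj : ℝ → (ℝ → ErrState n m) → Prop}
    (hR : ∃ R > 0, ∀ t₁, t₀ ≤ t₁ → ∀ z, Traj t₁ z → ∀ t, t₁ ≤ t →
      (z t).size ≤ R * (z t₁).size)
    (hη : ∀ η > 0, ∃ τ > 0, ∀ t₁, t₀ ≤ t₁ → ∀ z, Traj t₁ z → ∀ t, t₁ + τ ≤ t →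
      (z t).size ≤ η * (z t₁).size) :
    UniformlyAsymptoticallyStable t₀ Traj ∧ ReachesAccuracyInFiniteTime t₀ Traj := by
  refine ⟨⟨fun η hη0 => ?_, 1, one_pos, fun η hη0 => ?_⟩, fun ε₁ hε₁ δ hδ => ?_⟩
  · obtain ⟨R, hR0, hR⟩ := hR
    refine ⟨η / R, by positivity, fun t₁ ht₁ z hz hsz t ht => (hR t₁ ht₁ z hz t ht).trans_lt ?_⟩
    rwa [lt_div_iff₀' hR0] at hsz
  · obtain ⟨τ, hτ, h⟩ := hη η hη0
    exact ⟨τ, hτ, fun t₁ ht₁ z hz hsz t ht =>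
      (h t₁ ht₁ z hz t ht).trans_lt (mul_lt_of_lt_one_right hη0 hsz)⟩
  · obtain ⟨τ, hτ, h⟩ := hη (δ / ε₁) (by positivity)
    refine ⟨τ, hτ, fun t₁ ht₁ z hz hsz t ht => (z t).frobNorm_Th_le_size.trans
      ((h t₁ ht₁ z hz t ht).trans ?_)⟩
    rw [div_mul_eq_mul_div, div_le_iff₀ hε₁]
    exact mul_le_mul_of_nonneg_left hsz hδ.le

theorem theorem3 {n m : ℕ} (S : MSACData n m) (mode : GainAdaptation) (t₀ : ℝ)
    (hlam : ∀ i, 0 < S.lam i) (humax : 0 < S.umax)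
    (hAm : IsHurwitz S.Am) (hBm : S.Bm.rank = m)
    (hKx : S.Ap + S.Bp * S.Lam * S.Kx = S.Am) (hKr : S.Bp * S.Lam * S.Kr = S.Bm)
    (hQ : S.Q.PosDef) (hP : S.Am.transpose * S.P + S.P * S.Am = -S.Q)
    (hQlam : ∀ i, (S.Q - max 1 (S.lam i) • (1 : Matrix (Fin n) (Fin n) ℝ)).PosSemidef)
    (hγ : 0 < S.γ) (hβ : 0 < S.β)
    (hμ : 2 * S.γ / S.β * frobNorm (S.P * S.Bp) ^ 2 ≤ S.μ) :
    (∀ Φ : ℝ → RegIdx n m → ℝ, ContinuousOn Φ (Ici t₀) → PersistentlyExciting t₀ Φ →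
      UniformlyAsymptoticallyStable t₀ (IsErrorSolution S mode Φ) ∧
      ReachesAccuracyInFiniteTime t₀ (IsErrorSolution S mode Φ)) ∧
    (∀ C T δ₀ ε : ℝ, 0 < T → 0 < δ₀ → 0 < ε →
      UniformlyAsymptoticallyStable t₀ (ClosedLoopErr S mode C T δ₀ ε) ∧
      ReachesAccuracyInFiniteTime t₀ (ClosedLoopErr S mode C T δ₀ ε)) := by
  obtain ⟨p, L, w, h⟩ := S.exists_bounds hlam hAm hQ hP hQlam hγ hβ hμ
  -- Full column rank passes from `Bm` to `Bp` because `Bm` factors through `Bp`.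
  have hB : S.Bp.rank = m := by
    refine le_antisymm ((Matrix.rank_le_width _)) ?_
    refine hBm.symm.le.trans ?_
    rw [← hKr, Matrix.mul_assoc]
    exact Matrix.rank_mul_le_left _ _
  constructor
  · rintro Φ hΦ ⟨⟨C, hC⟩, T, δ₀, ε, hT, hδ₀, hε, hPE⟩
    have hC0 : 0 ≤ C := (l2norm_nonneg _).trans (hC t₀ le_rfl)
    obtain ⟨⟨R, hR0, hR⟩, hη⟩ := IsErrorSolution.exists_size_le h hB hC0 hT hδ₀ hε
    have hΦ' : ∀ t₁, t₀ ≤ t₁ → IsExcitingRegressor C T δ₀ ε t₁ Φ := fun t₁ ht₁ =>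
      ⟨hΦ.mono (Ici_subset_Ici.2 ht₁), fun t ht => hC t (ht₁.trans ht),
        fun t ht => hPE t (ht₁.trans ht)⟩
    refine uniformlyAsymptoticallyStable_and_reachesAccuracy
      ⟨R, hR0, fun t₁ ht₁ z hz => hR mode Φ t₁ z (hΦ' t₁ ht₁) hz⟩ fun η hη0 => ?_
    obtain ⟨τ, hτ, hτ'⟩ := hη η hη0
    exact ⟨τ, hτ, fun t₁ ht₁ z hz => hτ' mode Φ t₁ z (hΦ' t₁ ht₁) hz⟩
  · intro C T δ₀ ε hT hδ₀ hε
    -- C is arbitrary here and may be negative, hence max C 0.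
    obtain ⟨⟨R, hR0, hR⟩, hη⟩ :=
      IsErrorSolution.exists_size_le h hB (le_max_right C 0) hT hδ₀ hε
    -- Each trajectory brings its own regressor; this is harmless because R and τ were chosen before
    -- Φ.
    have hcl : ∀ t₁ z, ClosedLoopErr S mode C T δ₀ ε t₁ z → ∃ Φ,
        IsExcitingRegressor (max C 0) T δ₀ ε t₁ Φ ∧ IsErrorSolution S mode Φ t₁ z := by
      rintro t₁ z ⟨s, hs, hsC, hsPE, rfl⟩
      exact ⟨s.regressor S.umax, ⟨hs.continuousOn_regressor humax,
        fun t ht => (hsC t ht).trans (le_max_left _ _), hsPE⟩, hs.isErrorSolution hKx hKr⟩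
    refine uniformlyAsymptoticallyStable_and_reachesAccuracy ⟨R, hR0, fun t₁ _ z hz => ?_⟩
      fun η hη0 => ?_
    · obtain ⟨Φ, hΦ, hsol⟩ := hcl t₁ z hz
      exact hR mode Φ t₁ z hΦ hsol
    · obtain ⟨τ, hτ, hτ'⟩ := hη η hη0
      refine ⟨τ, hτ, fun t₁ _ z hz => ?_⟩
      obtain ⟨Φ, hΦ, hsol⟩ := hcl t₁ z hz
      exact hτ' mode Φ t₁ z hΦ hsol
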